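/- Let $(M,g)$ be a compact connected smooth Riemannian manifold (without boundary) of dimension $n\ge 3$. Let $R$ be its Riemann curvature tensor, with the sign convention that $R_{ijij}$ is the sectional curvature of the plane spanned by two vectors $e_i,e_j$ ($i\neq j$) of an orthonormal basis, and suppose that $(M,g)$ has harmonic curvature, i.e. $\sum_{m}\nabla_m R_{mjkl}=0$ in orthonormal frames. At a point with tangent space $V$ and orthonormal basis $e_1,\dots,e_n$, let $\bar R\colon S^2(V)\to S^2(V)$ be the linear operator with $\bar R(e_i\odot e_j)=\sum_{k,l}R_{kijl}\,e_k\odot e_l$, where $e_i\odot e_j=e_i\otimes e_j+e_j\otimes e_i$, and let the curvature operator of the second kind be $\mathring R=\mathrm{pr}_{S^2_0(V)}\circ\bar R|_{S^2_0(V)}$, a self-adjoint operator on the space $S^2_0(V)$ of trace-free symmetric 2-tensors. Let $\lambda_1\le\lambda_2\le\dots\le\lambda_N$, $N=\frac{(n-1)(n+2)}{2}$, be its eigenvalues, listed with multiplicity. For a real number $1\le k<N$ one says that $\mathring R$ is $k$-nonnegative if at every point of $M$ $$\lambda_1+\dots+\lambda_{\lfloor k\rfloor}+(k-\lfloor k\rfloor)\,\lambda_{\lfloor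 k\rfloor+1}\ \ge\ 0 .$$ If $\mathring R$ is $\frac{n(n+2)}{2(n+1)}$-nonnegative, then $(M,g)$ is Einstein: there is a constant $c\in\mathbb R$ with $\mathrm{Ric}=c\,g$ on $M$. -/

import Mathlib

open scoped Manifold ContDiff

noncomputable section

namespace HarmonicCurvature

/-! ### Local Riemannian geometry of a matrix-valued function `G = (g_ij)` on `ℝⁿ` -/

section Coordinates

variable {n : ℕ}

/-- The `i`-th partial derivative of `f` at `y`. -/
def partialDeriv (i : Fin n) (f : EuclideanSpace ℝ (Fin n) → ℝ)
    (y : EuclideanSpace ℝ (Fin n)) : ℝ :=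
  fderiv ℝ f y (EuclideanSpace.single i 1)

variable (G : EuclideanSpace ℝ (Fin n) → Matrix (Fin n) (Fin n) ℝ)

/-- The Christoffel symbols `Γ^k_ij` of the Levi-Civita connection. -/
def christoffel (i j k : Fin n) (y : EuclideanSpace ℝ (Fin n)) : ℝ :=
  (1 / 2) * ∑ l, (G y)⁻¹ k l *
    (partialDeriv i (fun z => G z j l) y + partialDeriv j (fun z => G z i l) y
      - partialDeriv l (fun z => G z i j) y)

/-- The coefficients of `R(∂_i, ∂_j) ∂_k = ∑ l, (curvatureUp G i j k l) ∂_l`, where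
`R(X, Y) Z = ∇_X ∇_Y Z - ∇_Y ∇_X Z - ∇_[X, Y] Z`. -/
def curvatureUp (i j k l : Fin n) (y : EuclideanSpace ℝ (Fin n)) : ℝ :=
  partialDeriv i (christoffel G j k l) y - partialDeriv j (christoffel G i k l) y
    + ∑ m, (christoffel G i m l y * christoffel G j k m y
      - christoffel G j m l y * christoffel G i k m y)

/-- The curvature tensor `R_ijkl = g(R(∂_i, ∂_j) ∂_l, ∂_k)`, with the sign for which `R_ijij` is the
sectional curvature in an orthonormal frame. -/
def curvature (i j k l : Fin n) (y : EuclideanSpace ℝ (Fin n)) : ℝ :=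
  ∑ m, G y k m * curvatureUp G i j l m y

/-- The Ricci tensor `Ric_ik = g^jl R_ijkl`. -/
def ricci (i k : Fin n) (y : EuclideanSpace ℝ (Fin n)) : ℝ :=
  ∑ j, ∑ l, (G y)⁻¹ j l * curvature G i j k l y

/-- The covariant derivative `∇_m R_ijkl` of the curvature tensor. -/
def nablaCurvature (m i j k l : Fin n) (y : EuclideanSpace ℝ (Fin n)) : ℝ :=
  partialDeriv m (curvature G i j k l) y
    - ∑ p, (christoffel G m i p y * curvature G p j k l y
      + christoffel G m j p y * curvature G i p k l y
      + christoffel G m k p y * curvature G i j p l y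
      + christoffel G m l p y * curvature G i j k p y)

/-- The divergence `g^mi ∇_m R_ijkl` of the curvature tensor. -/
def divCurvature (j k l : Fin n) (y : EuclideanSpace ℝ (Fin n)) : ℝ :=
  ∑ m, ∑ i, (G y)⁻¹ m i * nablaCurvature G m i j k l y

/-- The components `R(e_a, e_b, e_c, e_d)` of the curvature tensor at `y` in the frame
`e_a = ∑ i, A i a ∂_i`. -/
def frameCurvature (A : Matrix (Fin n) (Fin n) ℝ) (y : EuclideanSpace ℝ (Fin n))
    (a b c d : Fin n) : ℝ :=
  ∑ i, ∑ j, ∑ k, ∑ l, A i a * A j b * A k c * A l d * curvature G i j k l y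

end Coordinates

/-! ### The curvature operator of the second kind in an orthonormal frame -/

section Algebra

variable {n : ℕ}

/-- Trace-free symmetric 2-tensors, in components with respect to an orthonormal frame. -/
def tracelessSym (n : ℕ) : Submodule ℝ (Matrix (Fin n) (Fin n) ℝ) where
  carrier := {h | h.IsSymm ∧ h.trace = 0}
  add_mem' := fun ha hb => ⟨ha.1.add hb.1, by simp [Matrix.trace_add, ha.2, hb.2]⟩
  zero_mem' := ⟨Matrix.isSymm_zero, by simp⟩
  smul_mem' := fun c _ ha => ⟨ha.1.smul c, by simp [Matrix.trace_smul, ha.2]⟩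

/-- The operator determined on symmetric 2-tensors by
`e_i ⊙ e_j ↦ ∑ k l, R_kijl e_k ⊙ e_l`, where `u ⊙ v = u ⊗ v + v ⊗ u`; a symmetric `h` is
`(1 / 2) ∑ i j, h_ij e_i ⊙ e_j`. -/
def rBar (R : Fin n → Fin n → Fin n → Fin n → ℝ) :
    Matrix (Fin n) (Fin n) ℝ →ₗ[ℝ] Matrix (Fin n) (Fin n) ℝ where
  toFun h := Matrix.of fun k l => (1 / 2) * ∑ i, ∑ j, (R k i j l + R l i j k) * h i j
  map_add' h h' := by
    ext k l
    simp [mul_add, Finset.sum_add_distrib]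
  map_smul' c h := by
    ext k l
    simp only [Matrix.smul_apply, Matrix.of_apply, smul_eq_mul, RingHom.id_apply, Finset.mul_sum]
    refine Finset.sum_congr rfl fun i _ => Finset.sum_congr rfl fun j _ => ?_
    ring

/-- The orthogonal projection `T ↦ T - (tr T / n) g` from symmetric to trace-free symmetric
2-tensors, in components with respect to an orthonormal frame. -/
def removeTrace (n : ℕ) : Matrix (Fin n) (Fin n) ℝ →ₗ[ℝ] Matrix (Fin n) (Fin n) ℝ where
  toFun T := T - (T.trace / n) • (1 : Matrix (Fin n) (Fin n) ℝ)
  map_add' T T' := by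
    rw [Matrix.trace_add, add_div, add_smul]
    abel
  map_smul' c T := by
    rw [Matrix.trace_smul, RingHom.id_apply, smul_sub, smul_smul, smul_eq_mul, mul_div_assoc]

lemma removeTrace_rBar_mem (R : Fin n → Fin n → Fin n → Fin n → ℝ)
    (h : Matrix (Fin n) (Fin n) ℝ) : removeTrace n (rBar R h) ∈ tracelessSym n := by
  have hs : (rBar R h).IsSymm := by
    ext k l
    simp [rBar, add_comm]
  refine ⟨hs.sub (Matrix.isSymm_one.smul _), ?_⟩
  rcases Nat.eq_zero_or_pos n with rfl | hn
  · simp [Matrix.trace]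
  · have hn' : (n : ℝ) ≠ 0 := by exact_mod_cast hn.ne'
    simp [removeTrace, Matrix.trace_sub, Matrix.trace_smul, Matrix.trace_one, hn']

/-- The curvature operator of the second kind: `rBar` restricted to trace-free symmetric 2-tensors,
followed by the projection onto them. -/
def secondKind (R : Fin n → Fin n → Fin n → Fin n → ℝ) : Module.End ℝ (tracelessSym n) :=
  ((removeTrace n ∘ₗ rBar R) ∘ₗ (tracelessSym n).subtype).codRestrict (tracelessSym n)
    fun h => removeTrace_rBar_mem R h

/-- The eigenvalues of an endomorphism, with multiplicity, in non-decreasing order. -/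
def orderedEigenvalues {V : Type*} [AddCommGroup V] [Module ℝ V] [Module.Finite ℝ V]
    (T : Module.End ℝ V) : List ℝ :=
  T.charpoly.roots.sort (· ≤ ·)

/-- `T` is `k`-nonnegative: `λ_1 + ⋯ + λ_[k] + (k - [k]) λ_([k]+1) ≥ 0` for its ordered eigenvalues
(list positions start at `0`). -/
def IsKNonnegative {V : Type*} [AddCommGroup V] [Module ℝ V] [Module.Finite ℝ V]
    (k : ℝ) (T : Module.End ℝ V) : Prop :=
  0 ≤ ((orderedEigenvalues T).take ⌊k⌋₊).sum
    + (k - ⌊k⌋₊) * (orderedEigenvalues T).getD ⌊k⌋₊ 0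

end Algebra

/-! ### Riemannian manifolds -/

section Manifold

variable {n : ℕ} {M : Type*} [TopologicalSpace M] [ChartedSpace (EuclideanSpace ℝ (Fin n)) M]
  [IsManifold (𝓡 n) ∞ M]

/-- The components `g_ij = g(∂_i, ∂_j)` of the metric in a chart, as functions on its target. -/
def metricCoeff
    (g : Bundle.ContMDiffRiemannianMetric (𝓡 n) ∞ (EuclideanSpace ℝ (Fin n))
      (TangentSpace (𝓡 n) : M → Type _))
    (φ : OpenPartialHomeomorph M (EuclideanSpace ℝ (Fin n))) (y : EuclideanSpace ℝ (Fin n)) :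
    Matrix (Fin n) (Fin n) ℝ :=
  Matrix.of fun i j => g.inner (φ.symm y)
    (mfderiv (𝓡 n) (𝓡 n) φ.symm y (EuclideanSpace.single i (1 : ℝ)))
    (mfderiv (𝓡 n) (𝓡 n) φ.symm y (EuclideanSpace.single j (1 : ℝ)))

variable
  (g : Bundle.ContMDiffRiemannianMetric (𝓡 n) ∞ (EuclideanSpace ℝ (Fin n))
    (TangentSpace (𝓡 n) : M → Type _))

/-- Harmonic curvature: the curvature tensor is divergence free (in every smooth chart). -/
def HasHarmonicCurvature : Prop :=
  ∀ φ ∈ IsManifold.maximalAtlas (𝓡 n) ∞ M, ∀ y ∈ φ.target, ∀ j k l,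
    divCurvature (metricCoeff g φ) j k l y = 0

/-- The curvature operator of the second kind is `k`-nonnegative at every point; it is computed in
orthonormal frames `e_a = ∑ i, A i a ∂_i`, i.e. `Aᵀ G A = 1`. -/
def SecondKindKNonnegative (k : ℝ) : Prop :=
  ∀ φ ∈ IsManifold.maximalAtlas (𝓡 n) ∞ M, ∀ y ∈ φ.target,
    ∀ A : Matrix (Fin n) (Fin n) ℝ, A.transpose * metricCoeff g φ y * A = 1 →
      IsKNonnegative k (secondKind (frameCurvature (metricCoeff g φ) A y))

/-- Einstein metrics: `Ric = c g` for a constant `c`. -/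
def IsEinstein : Prop :=
  ∃ c : ℝ, ∀ φ ∈ IsManifold.maximalAtlas (𝓡 n) ∞ M, ∀ y ∈ φ.target, ∀ i j,
    ricci (metricCoeff g φ) i j y = c * metricCoeff g φ y i j

end Manifold

end HarmonicCurvature

end

/-!
Harmonic curvature means that `Ric` is a Codazzi tensor of constant trace. By compactness `|Ric|²`
has a maximum point; in a frame diagonalizing `Ric` there, with eigenvalues `ρ_i`, the Bochner
formula gives `∑ R_ijij (ρ_i - ρ_j)² ≤ 0`. With `ν_i = ρ_i - s / n`, half of this sum equals the
trace of `R̊` weighted by `ν ⊗ ν + ∑ (ν_i² / 2) (e_i ⊙ e_j) ⊗ (e_i ⊙ e_j)`, whose largest eigenvalue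
is at most `|ν|²` and whose trace is `n |ν|²`. If `ν ≠ 0`, then `k`-nonnegativity with `k < n` and
the fact that a weighted trace is least when the weight is concentrated on the smallest eigenvalues
force `R̊ ≥ 0`; hence `ρ_i ≥ 0` and then `∑ ρ_i ν_i² = 0`, so that `|ν|² = ∑ ρ_i ν_i = 0`, a
contradiction. Thus `|Ric|² = s² / n` at the maximum, so everywhere `|Ric|² ≤ s² / n`, which is the
equality case of the Cauchy-Schwarz inequality.
-/

noncomputable section

namespace HarmonicCurvature

/-! ### `k`-nonnegative operators -/

section Eigenvalues

section WeightedSums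

variable {N : ℕ} {μ v : Fin N → ℝ} {κ W : ℝ}

lemma mul_sum_Iio_add_le_sum_mul (hμ : Monotone μ) (m : Fin N) (hv0 : ∀ i, 0 ≤ v i)
    (hvW : ∀ i, v i ≤ W) (hv : ∑ i, v i = κ * W) :
    W * (∑ j ∈ Finset.Iio m, μ j + (κ - (m : ℕ)) * μ m) ≤ ∑ i, v i * μ i := by
  have hterm : ∀ j, (if j < m then W * (μ j - μ m) else 0) ≤ v j * (μ j - μ m) := by
    intro j
    split_ifs with hj
    · exact mul_le_mul_of_nonpos_right (hvW j) (sub_nonpos.2 (hμ hj.le))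
    · exact mul_nonneg (hv0 j) (sub_nonneg.2 (hμ (not_lt.1 hj)))
  have hsum := Finset.sum_le_sum fun j (_ : j ∈ Finset.univ) => hterm j
  rw [← Finset.sum_filter, Finset.filter_gt_eq_Iio, ← Finset.mul_sum, Finset.sum_sub_distrib,
    Finset.sum_const, Fin.card_Iio, nsmul_eq_mul] at hsum
  simp only [mul_sub, Finset.sum_sub_distrib, ← Finset.sum_mul, hv] at hsum
  linarith

lemma nonneg_of_sum_mul_nonpos (hμ : Monotone μ) {m : Fin N} {k : ℝ} (hk : 0 < k)
    (hkκ : k < κ) (hW : 0 < W) (hv0 : ∀ i, 0 ≤ v i) (hvW : ∀ i, v i ≤ W) (hv : ∑ i, v i = κ * W)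
    (hsum : ∑ i, v i * μ i ≤ 0) (hnonneg : 0 ≤ ∑ j ∈ Finset.Iio m, μ j + (k - (m : ℕ)) * μ m)
    (i : Fin N) : 0 ≤ μ i := by
  have hle : ∀ j ∈ Finset.Iio m, μ j ≤ μ m := fun j hj => hμ (Finset.mem_Iio.1 hj).le
  have hS : ∑ j ∈ Finset.Iio m, μ j ≤ (m : ℕ) * μ m := by
    simpa using Finset.sum_le_card_nsmul _ _ _ hle
  have hS' : ∑ j ∈ Finset.Iio m, μ j + (κ - (m : ℕ)) * μ m ≤ 0 :=
    nonpos_of_mul_nonpos_right ((mul_sum_Iio_add_le_sum_mul hμ m hv0 hvW hv).trans hsum) hW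
  have hm : μ m = 0 := by
    refine le_antisymm ?_ ?_
    · exact nonpos_of_mul_nonpos_right (a := κ - k) (by linarith) (sub_pos.2 hkκ)
    · exact nonneg_of_mul_nonneg_right (a := k) (by linarith) hk
  rcases lt_or_ge i m with him | hmi
  · have hS0 : ∑ j ∈ Finset.Iio m, μ j = 0 := by
      rw [hm, mul_zero] at hS hnonneg
      linarith
    exact ((Finset.sum_eq_zero_iff_of_nonpos fun j hj => (hle j hj).trans hm.le).1 hS0 i
      (Finset.mem_Iio.2 him)).ge
  · exact hm ▸ hμ hmi

end WeightedSums

variable {V : Type*} [NormedAddCommGroup V] [InnerProductSpace ℝ V] [FiniteDimensional ℝ V]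
  {T : Module.End ℝ V}

lemma orderedEigenvalues_eq (hT : T.IsSymmetric) :
    orderedEigenvalues T = List.ofFn fun i => hT.eigenvalues rfl (Fin.rev i) := by
  have hmono : Monotone fun i => hT.eigenvalues rfl (Fin.rev i) :=
    (hT.eigenvalues_antitone rfl).comp Fin.rev_anti
  refine List.Perm.eq_of_pairwise (le := (· ≤ ·)) (fun _ _ _ _ => le_antisymm)
    (Multiset.pairwise_sort _ _) (List.sortedLE_ofFn_iff.2 hmono).pairwise ?_
  rw [← Multiset.coe_eq_coe, orderedEigenvalues, Multiset.sort_eq,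
    hT.roots_charpoly_eq_eigenvalues rfl, ← Fin.univ_val_map]
  have hrev := congrArg Finset.val (Finset.map_univ_equiv (Fin.revPerm (n := Module.finrank ℝ V)))
  rw [Finset.map_val] at hrev
  conv_lhs => rw [← hrev, Multiset.map_map]
  exact Multiset.map_congr rfl fun i _ => by simp

lemma isKNonnegative_iff (hT : T.IsSymmetric) {k : ℝ} {m : Fin (Module.finrank ℝ V)}
    (hm : (m : ℕ) = ⌊k⌋₊) :
    IsKNonnegative k T ↔ 0 ≤ ∑ j ∈ Finset.Iio m, hT.eigenvalues rfl j.rev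
      + (k - (m : ℕ)) * hT.eigenvalues rfl m.rev := by
  rw [IsKNonnegative, orderedEigenvalues_eq hT, ← hm, List.sum_take_ofFn]
  simp [List.getD_eq_getElem?_getD, Finset.filter_gt_eq_Iio]

lemma inner_apply_self_eq_sum_eigenvalues (hT : T.IsSymmetric) (u : V) :
    inner ℝ (T u) u
      = ∑ i, hT.eigenvalues rfl i * inner ℝ (hT.eigenvectorBasis rfl i) u ^ 2 := by
  rw [← (hT.eigenvectorBasis rfl).sum_inner_mul_inner (T u) u]
  refine Finset.sum_congr rfl fun i _ => ?_
  rw [hT u, hT.apply_eigenvectorBasis, inner_smul_right, real_inner_comm u]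
  simp only [RCLike.ofReal_real_eq_id, id_eq]
  ring

lemma nonneg_of_isKNonnegative (hT : T.IsSymmetric) {k κ W : ℝ} (hk : 0 < k) (hkκ : k < κ)
    (hW : 0 < W) (hnonneg : IsKNonnegative k T) {ι : Type*} [Fintype ι] {c : ι → ℝ} {w : ι → V}
    (hc : ∀ a, 0 ≤ c a) (hframe : ∀ u, ∑ a, c a * inner ℝ (w a) u ^ 2 ≤ W * ‖u‖ ^ 2)
    (htotal : ∑ a, c a * ‖w a‖ ^ 2 = κ * W) (hsum : ∑ a, c a * inner ℝ (T (w a)) (w a) ≤ 0)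
    (u : V) : 0 ≤ inner ℝ (T u) u := by
  set b := hT.eigenvectorBasis rfl
  set μ := fun i => hT.eigenvalues rfl (Fin.rev i) with hμ
  set v := fun i => ∑ a, c a * inner ℝ (b (Fin.rev i)) (w a) ^ 2 with hv
  have hμmono : Monotone μ := (hT.eigenvalues_antitone rfl).comp Fin.rev_anti
  have hv0 : ∀ i, 0 ≤ v i := fun i =>
    Finset.sum_nonneg fun a _ => mul_nonneg (hc a) (sq_nonneg _)
  have hvW : ∀ i, v i ≤ W := fun i => by
    simpa [hv, real_inner_comm, b.norm_eq_one] using hframe (b (Fin.rev i))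
  have hvsum : ∑ i, v i = κ * W := by
    rw [← htotal, Finset.sum_comm]
    refine Finset.sum_congr rfl fun a _ => ?_
    rw [← Finset.mul_sum, ← b.sum_sq_inner_right (w a)]
    exact congrArg _ (Equiv.sum_comp Fin.revPerm fun i => inner ℝ (b i) (w a) ^ 2)
  have hvμ : ∑ i, v i * μ i ≤ 0 := by
    refine le_of_eq_of_le ?_ hsum
    simp only [hv, Finset.sum_mul]
    rw [Finset.sum_comm]
    refine Finset.sum_congr rfl fun a _ => ?_
    rw [inner_apply_self_eq_sum_eigenvalues hT, Finset.mul_sum, ← Equiv.sum_comp Fin.revPerm]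
    refine Finset.sum_congr rfl fun i _ => ?_
    rw [mul_assoc, mul_comm (_ ^ 2)]
    simp only [hμ, Fin.revPerm_apply, Fin.rev_rev, b]
  have hκ : κ ≤ Module.finrank ℝ V := by
    have h := Finset.sum_le_card_nsmul Finset.univ v W fun i _ => hvW i
    rw [hvsum, Finset.card_univ, Fintype.card_fin, nsmul_eq_mul] at h
    exact le_of_mul_le_mul_right h hW
  have hm : ⌊k⌋₊ < Module.finrank ℝ V := (Nat.floor_lt hk.le).2 (hkκ.trans_le hκ)
  have hμ0 := nonneg_of_sum_mul_nonpos hμmono (m := ⟨_, hm⟩) hk hkκ hW hv0 hvW hvsum hvμ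
    ((isKNonnegative_iff hT rfl).1 hnonneg)
  rw [inner_apply_self_eq_sum_eigenvalues hT]
  exact Finset.sum_nonneg fun i _ => mul_nonneg (by simpa [hμ] using hμ0 i.rev) (sq_nonneg _)

end Eigenvalues

/-! ### The Bochner curvature term and the curvature operator of the second kind -/

section SecondKind

variable {n : ℕ} {R : Fin n → Fin n → Fin n → Fin n → ℝ} {ν : Fin n → ℝ}

lemma sum_comm_pairs {ι : Type*} [Fintype ι] (f : ι → ι → ι → ι → ℝ) :
    ∑ a, ∑ b, ∑ c, ∑ d, f a b c d = ∑ c, ∑ d, ∑ a, ∑ b, f a b c d := by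
  simp only [fun a b => (Fintype.sum_prod_type' (f := f a b)).symm]
  rw [← Fintype.sum_prod_type' (f := fun a b => ∑ x : ι × ι, f a b x.1 x.2), Finset.sum_comm,
    Fintype.sum_prod_type]
  simp only [Fintype.sum_prod_type]

lemma sum_sum_eq_diag_add_offDiag {ι : Type*} [Fintype ι] [DecidableEq ι] (f : ι → ι → ℝ) :
    ∑ a, ∑ b, f a b = ∑ a, f a a + ∑ a, ∑ b, if a = b then 0 else f a b := by
  rw [← Finset.sum_add_distrib]
  refine Finset.sum_congr rfl fun a _ => ?_
  rw [← Fintype.sum_ite_eq a (f a), ← Finset.sum_add_distrib]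
  exact Finset.sum_congr rfl fun b _ => by split_ifs <;> simp

/-- The Frobenius inner product on trace-free symmetric matrices. -/
@[reducible]
def frobeniusCore (n : ℕ) : InnerProductSpace.Core ℝ (tracelessSym n) where
  inner A B := ∑ i, ∑ j, A.1 i j * B.1 i j
  conj_inner_symm A B := by simp [mul_comm]
  re_inner_nonneg A := show (0 : ℝ) ≤ ∑ i, ∑ j, A.1 i j * A.1 i j from
    Finset.sum_nonneg fun i _ => Finset.sum_nonneg fun j _ => mul_self_nonneg _
  add_left A B C := by simp [add_mul, Finset.sum_add_distrib]
  smul_left A B r := by simp [Finset.mul_sum, mul_assoc]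
  definite A hA := by
    have h1 := (Finset.sum_eq_zero_iff_of_nonneg fun i _ =>
      Finset.sum_nonneg fun j _ => mul_self_nonneg _).1 hA
    ext i j
    have h2 := (Finset.sum_eq_zero_iff_of_nonneg fun j _ => mul_self_nonneg _).1
      (h1 i (Finset.mem_univ i)) j (Finset.mem_univ j)
    simpa using h2

/-- Trace-free symmetric matrices, normed by the Frobenius inner product. -/
@[reducible]
def frobeniusNormedAddCommGroup (n : ℕ) : NormedAddCommGroup (tracelessSym n) :=
  (frobeniusCore n).toNormedAddCommGroup

attribute [local instance] frobeniusNormedAddCommGroup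

/-- Trace-free symmetric matrices as an inner product space, under the Frobenius inner product. -/
@[reducible]
def frobeniusInnerProductSpace (n : ℕ) : InnerProductSpace ℝ (tracelessSym n) :=
  InnerProductSpace.ofCore (frobeniusCore n).toCore

attribute [local instance] frobeniusInnerProductSpace

lemma inner_eq_sum_mul (A B : tracelessSym n) : inner ℝ A B = ∑ i, ∑ j, A.1 i j * B.1 i j :=
  rfl

lemma norm_sq_eq_sum_sq (A : tracelessSym n) : ‖A‖ ^ 2 = ∑ i, ∑ j, A.1 i j ^ 2 := by
  rw [← real_inner_self_eq_norm_sq, inner_eq_sum_mul]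
  simp only [sq]

lemma inner_secondKind_eq_inner_rBar (R : Fin n → Fin n → Fin n → Fin n → ℝ)
    (h u : tracelessSym n) :
    inner ℝ (secondKind R h) u = ∑ k, ∑ l, rBar R h.1 k l * u.1 k l := by
  have happly : ∀ k l, (secondKind R h).1 k l
      = rBar R h.1 k l - (rBar R h.1).trace / n * (1 : Matrix (Fin n) (Fin n) ℝ) k l :=
    fun k l => rfl
  have htrace : ∑ k, ∑ l, (1 : Matrix (Fin n) (Fin n) ℝ) k l * u.1 k l = 0 := by
    simpa [Matrix.one_apply, Matrix.trace] using u.2.2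
  simp only [inner_eq_sum_mul, happly, sub_mul, Finset.sum_sub_distrib, mul_assoc]
  simp only [← Finset.mul_sum, htrace, mul_zero, sub_zero]

lemma inner_secondKind (R : Fin n → Fin n → Fin n → Fin n → ℝ) (h u : tracelessSym n) :
    inner ℝ (secondKind R h) u
      = ∑ k, ∑ l, ∑ i, ∑ j, R k i j l * h.1 i j * u.1 k l := by
  have hswap : ∑ k, ∑ l, ∑ i, ∑ j, R k i j l * h.1 i j * u.1 k l
      = ∑ k, ∑ l, ∑ i, ∑ j, R l i j k * h.1 i j * u.1 k l := by
    rw [Finset.sum_comm]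
    simp only [u.2.1.apply]
  rw [inner_secondKind_eq_inner_rBar,
    ← add_halves (∑ k, ∑ l, ∑ i, ∑ j, R k i j l * h.1 i j * u.1 k l)]
  nth_rewrite 2 [hswap]
  simp only [rBar, LinearMap.coe_mk, AddHom.coe_mk, Matrix.of_apply, Finset.sum_div,
    ← Finset.sum_add_distrib, Finset.mul_sum, Finset.sum_mul]
  refine Finset.sum_congr rfl fun k _ => Finset.sum_congr rfl fun l _ =>
    Finset.sum_congr rfl fun i _ => Finset.sum_congr rfl fun j _ => ?_
  ring

/-- The symmetric matrix `e_i ⊙ e_j` for `i ≠ j`, with the junk value `0` for `i = j`. -/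
def symUnit (i j : Fin n) : tracelessSym n :=
  if h : i = j then 0 else
    ⟨Matrix.single i j 1 + Matrix.single j i 1, by
      refine ⟨?_, ?_⟩
      · rw [Matrix.IsSymm, Matrix.transpose_add, Matrix.transpose_single, Matrix.transpose_single,
          add_comm]
      · rw [Matrix.trace_add, Matrix.trace_single_eq_of_ne _ _ _ h,
          Matrix.trace_single_eq_of_ne _ _ _ (Ne.symm h), add_zero]⟩

lemma symUnit_self (i : Fin n) : symUnit i i = 0 := by simp [symUnit]

lemma symUnit_apply {i j : Fin n} (hij : i ≠ j) (a b : Fin n) :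
    (symUnit i j).1 a b = Matrix.single i j (1 : ℝ) a b + Matrix.single j i 1 a b := by
  simp [symUnit, hij]

lemma sum_symUnit_mul {i j : Fin n} (hij : i ≠ j) (u : Fin n → Fin n → ℝ) :
    ∑ a, ∑ b, (symUnit i j).1 a b * u a b = u i j + u j i := by
  simp only [symUnit_apply hij, Matrix.single_apply, add_mul, ite_and, ite_mul, one_mul, zero_mul,
    Finset.sum_add_distrib, Finset.sum_ite_irrel, Finset.sum_ite_eq, Finset.mem_univ, if_true,
    Finset.sum_const_zero]

lemma inner_symUnit (i j : Fin n) (u : tracelessSym n) :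
    inner ℝ (symUnit i j) u = if i = j then 0 else 2 * u.1 i j := by
  split_ifs with hij
  · rw [hij, symUnit_self, inner_zero_left]
  · rw [inner_eq_sum_mul, sum_symUnit_mul hij u.1, u.2.1.apply i j, two_mul]

lemma norm_symUnit_sq (i j : Fin n) : ‖symUnit i j‖ ^ 2 = if i = j then 0 else 2 := by
  rw [← real_inner_self_eq_norm_sq, inner_symUnit]
  split_ifs with hij
  · rfl
  · simp [symUnit_apply hij, hij]

/-- The diagonal matrix with entries `ν`, as a trace-free symmetric matrix. -/
def tracelessDiagonal (ν : Fin n → ℝ) (hν : ∑ j, ν j = 0) : tracelessSym n :=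
  ⟨Matrix.diagonal ν, Matrix.isSymm_diagonal ν, (Matrix.trace_diagonal ν).trans hν⟩

lemma sum_tracelessDiagonal_mul (hν : ∑ j, ν j = 0) (u : Fin n → Fin n → ℝ) :
    ∑ a, ∑ b, (tracelessDiagonal ν hν).1 a b * u a b = ∑ a, ν a * u a a := by
  simp [tracelessDiagonal, Matrix.diagonal_apply]

lemma inner_tracelessDiagonal (hν : ∑ j, ν j = 0) (u : tracelessSym n) :
    inner ℝ (tracelessDiagonal ν hν) u = ∑ a, ν a * u.1 a a :=
  sum_tracelessDiagonal_mul hν u.1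

lemma norm_tracelessDiagonal_sq (hν : ∑ j, ν j = 0) :
    ‖tracelessDiagonal ν hν‖ ^ 2 = ∑ a, ν a ^ 2 := by
  rw [← real_inner_self_eq_norm_sq, inner_tracelessDiagonal]
  simp [tracelessDiagonal, sq]

/-- The antisymmetries of a curvature tensor in its first and in its last pair of indices. -/
structure IsPairAntisymm (R : Fin n → Fin n → Fin n → Fin n → ℝ) : Prop where
  swap_left : ∀ i j k l, R i j k l = -R j i k l
  swap_right : ∀ i j k l, R i j k l = -R i j l k

namespace IsPairAntisymm

variable (hR : IsPairAntisymm R)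
include hR

lemma self_left (i k l : Fin n) : R i i k l = 0 := by linarith [hR.swap_left i i k l]

lemma swap_both (i j k l : Fin n) : R i j k l = R j i l k := by
  rw [hR.swap_left, hR.swap_right j i, neg_neg]

lemma secondKind_isSymmetric : (secondKind R).IsSymmetric := by
  intro A B
  rw [real_inner_comm (secondKind R B) A, inner_secondKind, inner_secondKind, sum_comm_pairs]
  refine Finset.sum_congr rfl fun a _ => Finset.sum_congr rfl fun b _ =>
    Finset.sum_congr rfl fun c _ => Finset.sum_congr rfl fun d _ => ?_
  rw [hR.swap_both c a b d]
  ring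

lemma inner_secondKind_symUnit (i j : Fin n) :
    inner ℝ (secondKind R (symUnit i j)) (symUnit i j) = 2 * R i j i j := by
  rcases eq_or_ne i j with rfl | hij
  · rw [symUnit_self, map_zero, inner_zero_left, hR.self_left, mul_zero]
  have hcontract : ∀ k l, ∑ a, ∑ b, R k a b l * (symUnit i j).1 a b * (symUnit i j).1 k l
      = (symUnit i j).1 k l * (R k i j l + R k j i l) := by
    intro k l
    simp only [← Finset.sum_mul, mul_comm (R k _ _ l), sum_symUnit_mul hij fun a b => R k a b l]
    ring
  rw [inner_secondKind]
  simp only [hcontract]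
  rw [sum_symUnit_mul hij fun k l => R k i j l + R k j i l, hR.self_left, hR.self_left,
    hR.swap_both j i]
  ring

lemma inner_secondKind_tracelessDiagonal (hν : ∑ j, ν j = 0) :
    inner ℝ (secondKind R (tracelessDiagonal ν hν)) (tracelessDiagonal ν hν)
      = -∑ a, ∑ b, R a b a b * (ν a * ν b) := by
  have hcontract : ∀ a b, ∑ c, ∑ d, R a c d b * (tracelessDiagonal ν hν).1 c d
        * (tracelessDiagonal ν hν).1 a b
      = (tracelessDiagonal ν hν).1 a b * ∑ c, ν c * R a c c b := by
    intro a b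
    simp only [← Finset.sum_mul, mul_comm (R a _ _ b),
      sum_tracelessDiagonal_mul hν fun c d => R a c d b]
    ring
  rw [inner_secondKind]
  simp only [hcontract]
  rw [sum_tracelessDiagonal_mul hν fun a b => ∑ c, ν c * R a c c b, ← Finset.sum_neg_distrib]
  refine Finset.sum_congr rfl fun a _ => ?_
  rw [Finset.mul_sum, ← Finset.sum_neg_distrib]
  refine Finset.sum_congr rfl fun c _ => ?_
  rw [hR.swap_right a c c a]
  ring

lemma sum_mul_sub_sq (hν : ∑ j, ν j = 0) :
    ∑ a, ∑ b, R a b a b * (ν a - ν b) ^ 2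
      = 2 * (∑ a, ∑ b, R a b a b * ν a ^ 2
        + inner ℝ (secondKind R (tracelessDiagonal ν hν)) (tracelessDiagonal ν hν)) := by
  have hswap : ∑ a, ∑ b, R a b a b * ν a ^ 2 = ∑ a, ∑ b, R a b a b * ν b ^ 2 := by
    rw [Finset.sum_comm]
    exact Finset.sum_congr rfl fun a _ => Finset.sum_congr rfl fun b _ => by rw [hR.swap_both]
  rw [hR.inner_secondKind_tracelessDiagonal, mul_add, two_mul]
  nth_rewrite 2 [hswap]
  simp only [mul_neg, Finset.mul_sum, ← Finset.sum_neg_distrib, ← Finset.sum_add_distrib]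
  refine Finset.sum_congr rfl fun a _ => Finset.sum_congr rfl fun b _ => ?_
  ring

end IsPairAntisymm

lemma sum_offDiag_mul_sq_le (ν : Fin n → ℝ) {u : Matrix (Fin n) (Fin n) ℝ} (hu : u.IsSymm) :
    ∑ a, ∑ b, ν a ^ 2 / 2 * (if a = b then 0 else 2 * u a b) ^ 2
      ≤ (∑ j, ν j ^ 2) * ∑ a, ∑ b, if a = b then 0 else u a b ^ 2 := by
  have hpair : ∀ a b : Fin n, a ≠ b → ν a ^ 2 + ν b ^ 2 ≤ ∑ j, ν j ^ 2 := by
    intro a b hab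
    rw [← Finset.sum_pair (f := fun j => ν j ^ 2) hab]
    exact Finset.sum_le_sum_of_subset_of_nonneg (Finset.subset_univ _) fun j _ _ => sq_nonneg _
  have hswap : ∑ a, ∑ b, ν a ^ 2 / 2 * (if a = b then 0 else 2 * u a b) ^ 2
      = ∑ a, ∑ b, ν b ^ 2 / 2 * (if a = b then 0 else 2 * u a b) ^ 2 := by
    rw [Finset.sum_comm]
    refine Finset.sum_congr rfl fun a _ => Finset.sum_congr rfl fun b _ => ?_
    rw [hu.apply a b]
    simp only [eq_comm]
  rw [← add_halves (∑ a, ∑ b, ν a ^ 2 / 2 * (if a = b then 0 else 2 * u a b) ^ 2)]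
  nth_rewrite 2 [hswap]
  simp only [Finset.sum_div, ← Finset.sum_add_distrib, Finset.mul_sum _ _ (∑ j, ν j ^ 2)]
  refine Finset.sum_le_sum fun a _ => Finset.sum_le_sum fun b _ => ?_
  split_ifs with hab
  · simp
  · linarith [mul_le_mul_of_nonneg_right (hpair a b hab) (sq_nonneg (u a b))]

lemma inner_tracelessDiagonal_sq_add_le (hν : ∑ j, ν j = 0) (u : tracelessSym n) :
    inner ℝ (tracelessDiagonal ν hν) u ^ 2 + ∑ a, ∑ b, ν a ^ 2 / 2 * inner ℝ (symUnit a b) u ^ 2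
      ≤ (∑ j, ν j ^ 2) * ‖u‖ ^ 2 := by
  rw [norm_sq_eq_sum_sq, sum_sum_eq_diag_add_offDiag fun i j => u.1 i j ^ 2, mul_add,
    inner_tracelessDiagonal]
  simp only [inner_symUnit]
  exact add_le_add (Finset.sum_mul_sq_le_sq_mul_sq _ _ _) (sum_offDiag_mul_sq_le ν u.2.1)

lemma norm_tracelessDiagonal_sq_add (hν : ∑ j, ν j = 0) :
    ‖tracelessDiagonal ν hν‖ ^ 2 + ∑ a, ∑ b, ν a ^ 2 / 2 * ‖symUnit a b‖ ^ 2
      = n * ∑ j, ν j ^ 2 := by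
  have hterm : ∀ a b, ν a ^ 2 / 2 * ‖symUnit a b‖ ^ 2
      = ν a ^ 2 - if a = b then ν a ^ 2 else 0 := by
    intro a b
    rw [norm_symUnit_sq]
    split_ifs <;> ring
  simp only [norm_tracelessDiagonal_sq, hterm, Finset.sum_sub_distrib, Finset.sum_ite_eq,
    Finset.mem_univ, if_true, Finset.sum_const, Finset.card_univ, Fintype.card_fin, nsmul_eq_mul,
    ← Finset.mul_sum]
  ring

/-- Half the Bochner term is the weighted trace of `R̊` over the diagonal matrix `ν` and the
`e_a ⊙ e_b` with weights `ν_a² / 2`, a family of frame bound `|ν|²` and total mass `n |ν|²`. -/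
lemma inner_secondKind_nonneg (hR : IsPairAntisymm R) {k : ℝ} (hk : 0 < k) (hkn : k < n)
    (hnonneg : IsKNonnegative k (secondKind R)) (hν : ∑ j, ν j = 0) (hν0 : 0 < ∑ j, ν j ^ 2)
    (hbochner : ∑ a, ∑ b, R a b a b * (ν a - ν b) ^ 2 ≤ 0) (u : tracelessSym n) :
    0 ≤ inner ℝ (secondKind R u) u := by
  refine nonneg_of_isKNonnegative (ι := Option (Fin n × Fin n)) (κ := n)
    (c := fun o => o.elim 1 fun p => ν p.1 ^ 2 / 2)
    (w := fun o => o.elim (tracelessDiagonal ν hν) fun p => symUnit p.1 p.2)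
    hR.secondKind_isSymmetric hk hkn hν0 hnonneg ?_ (fun u => ?_) ?_ ?_ u
  · rintro (_ | p)
    · exact zero_le_one
    · exact div_nonneg (sq_nonneg _) zero_le_two
  all_goals simp only [Fintype.sum_option, Option.elim, Fintype.sum_prod_type, one_mul]
  · exact inner_tracelessDiagonal_sq_add_le hν u
  · exact norm_tracelessDiagonal_sq_add hν
  · rw [hR.sum_mul_sub_sq hν] at hbochner
    have hterm : ∀ a b, ν a ^ 2 / 2 * (2 * R a b a b) = R a b a b * ν a ^ 2 := fun a b => by ring
    simp only [hR.inner_secondKind_symUnit, hterm]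
    linarith

lemma ricci_mul_eq_zero (hR : IsPairAntisymm R)
    (hsecond : ∀ u, 0 ≤ inner ℝ (secondKind R u) u) {ρ : Fin n → ℝ}
    (hρ : ∀ i, ρ i = ∑ j, R i j i j) (hν : ∑ j, ν j = 0)
    (hbochner : ∑ a, ∑ b, R a b a b * (ν a - ν b) ^ 2 ≤ 0) (i : Fin n) : ρ i * ν i = 0 := by
  have hρ0 : ∀ a, 0 ≤ ρ a := fun a => by
    rw [hρ]
    refine Finset.sum_nonneg fun b _ => ?_
    linarith [hsecond (symUnit a b), hR.inner_secondKind_symUnit a b]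
  have hnn : ∀ a ∈ Finset.univ, 0 ≤ ρ a * ν a ^ 2 := fun a _ => mul_nonneg (hρ0 a) (sq_nonneg _)
  have hsum : ∑ a, ρ a * ν a ^ 2 ≤ 0 := by
    simp only [hρ, Finset.sum_mul]
    linarith [hR.sum_mul_sub_sq hν, hsecond (tracelessDiagonal ν hν)]
  simpa using (Finset.sum_eq_zero_iff_of_nonneg hnn).1
    (hsum.antisymm (Finset.sum_nonneg hnn)) i (Finset.mem_univ i)

theorem eq_average_of_isKNonnegative (hR : IsPairAntisymm R) {k : ℝ} (hk : 0 < k) (hkn : k < n)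
    (hnonneg : IsKNonnegative k (secondKind R)) {ρ : Fin n → ℝ} (hρ : ∀ i, ρ i = ∑ j, R i j i j)
    (hbochner : ∑ i, ∑ j, R i j i j * (ρ i - ρ j) ^ 2 ≤ 0) (i : Fin n) :
    ρ i = (∑ j, ρ j) / n := by
  set s := (∑ j, ρ j) / n with hs
  set ν : Fin n → ℝ := fun j => ρ j - s with hνdef
  have hν : ∑ j, ν j = 0 := by
    have hn : (n : ℝ) ≠ 0 := (hk.trans hkn).ne'
    simp only [hνdef, Finset.sum_sub_distrib, Finset.sum_const, Finset.card_univ,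
      Fintype.card_fin, nsmul_eq_mul, hs, mul_div_cancel₀ _ hn, sub_self]
  suffices hzero : ∑ j, ν j ^ 2 = 0 by
    have := (Finset.sum_eq_zero_iff_of_nonneg fun j _ => sq_nonneg (ν j)).1 hzero i
      (Finset.mem_univ i)
    exact sub_eq_zero.1 (pow_eq_zero_iff two_ne_zero |>.1 this)
  by_contra hne
  have hpos : 0 < ∑ j, ν j ^ 2 :=
    (Finset.sum_nonneg fun j _ => sq_nonneg _).lt_of_ne (Ne.symm hne)
  replace hbochner : ∑ a, ∑ b, R a b a b * (ν a - ν b) ^ 2 ≤ 0 := by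
    simpa only [hνdef, sub_sub_sub_cancel_right] using hbochner
  have hsecond := inner_secondKind_nonneg hR hk hkn hnonneg hν hpos hbochner
  refine hne ?_
  calc ∑ j, ν j ^ 2 = ∑ j, ρ j * ν j - s * ∑ j, ν j := by
        rw [Finset.mul_sum, ← Finset.sum_sub_distrib]
        exact Finset.sum_congr rfl fun j _ => by rw [← sub_mul, sq]
    _ = 0 := by rw [hν, mul_zero, sub_zero, Finset.sum_eq_zero fun a _ =>
      ricci_mul_eq_zero hR hsecond hρ hν hbochner a]

end SecondKind

/-! ### Simultaneous diagonalization -/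

section Diagonalization

variable {ι : Type*} [Fintype ι] [DecidableEq ι] {P S C : Matrix ι ι ℝ}

open scoped MatrixOrder Matrix.Norms.L2Operator in
lemma exists_transpose_mul_mul_eq_one (hP : P.PosDef) :
    ∃ C : Matrix ι ι ℝ, C.transpose * P * C = 1 := by
  obtain ⟨B, hB⟩ := CStarAlgebra.nonneg_iff_eq_star_mul_self.mp hP.posSemidef.nonneg
  rw [Matrix.star_eq_conjTranspose, Matrix.conjTranspose_eq_transpose_of_trivial] at hB
  have hdet : IsUnit B.det :=
    isUnit_iff_ne_zero.2 fun h => hP.det_pos.ne' (by rw [hB, Matrix.det_mul, h, mul_zero])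
  refine ⟨B⁻¹, ?_⟩
  rw [hB, ← mul_assoc, ← Matrix.transpose_mul, Matrix.mul_nonsing_inv _ hdet,
    Matrix.transpose_one, one_mul, Matrix.mul_nonsing_inv _ hdet]

lemma isUnit_det_of_transpose_mul_mul (hC : C.transpose * P * C = 1) : IsUnit C.det :=
  Matrix.isUnit_det_of_left_inverse hC

lemma inv_eq_mul_transpose (hC : C.transpose * P * C = 1) : P⁻¹ = C * C.transpose := by
  refine Matrix.inv_eq_left_inv ?_
  rw [mul_assoc, mul_eq_one_comm.1 hC]

lemma exists_orthogonal_diagonal (hS : S.IsSymm) :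
    ∃ (Q : Matrix ι ι ℝ) (d : ι → ℝ),
      Q.transpose * Q = 1 ∧ Q.transpose * S * Q = Matrix.diagonal d := by
  have hH : S.IsHermitian := Matrix.isHermitian_iff_isSymm.2 hS
  refine ⟨hH.eigenvectorUnitary.1, hH.eigenvalues, ?_, ?_⟩
  · simpa [Matrix.star_eq_conjTranspose] using hH.eigenvectorUnitary.2.1
  · simpa [Unitary.conjStarAlgAut_apply, Matrix.star_eq_conjTranspose, Function.comp_def]
      using hH.conjStarAlgAut_star_eigenvectorUnitary

lemma exists_frame_diagonal (hP : P.PosDef) (hS : S.IsSymm) :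
    ∃ (A : Matrix ι ι ℝ) (d : ι → ℝ),
      A.transpose * P * A = 1 ∧ A.transpose * S * A = Matrix.diagonal d := by
  obtain ⟨C, hC⟩ := exists_transpose_mul_mul_eq_one hP
  obtain ⟨Q, d, hQ, hQd⟩ := exists_orthogonal_diagonal
    (S := C.transpose * S * C) (by simp [Matrix.IsSymm, hS.eq, mul_assoc])
  have hassoc : ∀ Z, (C * Q).transpose * Z * (C * Q)
      = Q.transpose * (C.transpose * Z * C) * Q := fun Z => by
    rw [Matrix.transpose_mul]
    simp only [mul_assoc]
  exact ⟨C * Q, d, by rw [hassoc, hC, mul_one, hQ], by rw [hassoc, hQd]⟩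

lemma eq_zero_of_trace_sq_nonpos (hP : P.PosDef) (hS : S.IsSymm)
    (h : (P⁻¹ * S * (P⁻¹ * S)).trace ≤ 0) : S = 0 := by
  obtain ⟨C, hC⟩ := exists_transpose_mul_mul_eq_one hP
  set Z := C.transpose * S * C with hZ
  have hZs : Z.conjTranspose = Z := by simp [hZ, hS.eq, mul_assoc]
  have htrace : (P⁻¹ * S * (P⁻¹ * S)).trace = (Z.conjTranspose * Z).trace := by
    rw [hZs, hZ, inv_eq_mul_transpose hC]
    simp only [mul_assoc]
    rw [Matrix.trace_mul_comm]
    simp only [mul_assoc]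
  have hZ0 : Z = 0 := Matrix.trace_conjTranspose_mul_self_eq_zero_iff.1
    ((htrace ▸ h).antisymm (Matrix.posSemidef_conjTranspose_mul_self Z).trace_nonneg)
  have hunit := isUnit_det_of_transpose_mul_mul hC
  rwa [hZ, Matrix.isUnit_iff_isUnit_det _ |>.2 hunit |>.mul_left_eq_zero,
    Matrix.isUnit_iff_isUnit_det _ |>.2 (C.isUnit_det_transpose hunit) |>.mul_right_eq_zero] at hZ0

/-- Equality in the Cauchy-Schwarz inequality `(tr H)² ≤ n tr H²` for `H = P⁻¹ S`. -/
lemma eq_smul_of_trace_sq_le (hP : P.PosDef) (hS : S.IsSymm)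
    (h : (P⁻¹ * S * (P⁻¹ * S)).trace ≤ (P⁻¹ * S).trace ^ 2 / Fintype.card ι) :
    S = ((P⁻¹ * S).trace / Fintype.card ι) • P := by
  rcases isEmpty_or_nonempty ι with hι | hι
  · exact Subsingleton.elim _ _
  have hcard : (Fintype.card ι : ℝ) ≠ 0 := Nat.cast_ne_zero.2 Fintype.card_ne_zero
  set H := P⁻¹ * S
  set c := H.trace / Fintype.card ι with hc
  refine sub_eq_zero.1 (eq_zero_of_trace_sq_nonpos hP ?_ ?_)
  · exact hS.sub ((Matrix.isHermitian_iff_isSymm.1 hP.isHermitian).smul c)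
  have hsub : P⁻¹ * (S - c • P) = H - c • 1 := by
    rw [mul_sub, mul_smul_comm, Matrix.nonsing_inv_mul _ hP.det_pos.ne'.isUnit]
  calc (P⁻¹ * (S - c • P) * (P⁻¹ * (S - c • P))).trace
      = (H * H).trace - 2 * c * H.trace + c ^ 2 * Fintype.card ι := by
        simp only [hsub, sub_mul, mul_sub, smul_mul_assoc, mul_smul_comm, mul_one, one_mul,
          Matrix.trace_sub, Matrix.trace_smul, Matrix.trace_one, smul_eq_mul]
        ring
    _ = (H * H).trace - H.trace ^ 2 / Fintype.card ι := by
        rw [hc]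
        field_simp
        ring
    _ ≤ 0 := sub_nonpos.2 h

end Diagonalization

open scoped Matrix.Norms.Operator

section Calculus

variable {n : ℕ} {F : Type*} [NormedAddCommGroup F] [NormedSpace ℝ F]
  {𝔸 : Type*} [NormedRing 𝔸] [NormedAlgebra ℝ 𝔸]
  {y : EuclideanSpace ℝ (Fin n)} {i j : Fin n}

/-- The `i`-th partial derivative of a vector-valued function. -/
def pderiv (i : Fin n) (f : EuclideanSpace ℝ (Fin n) → F) (y : EuclideanSpace ℝ (Fin n)) : F :=
  fderiv ℝ f y (EuclideanSpace.single i 1)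

lemma partialDeriv_eq_pderiv (f : EuclideanSpace ℝ (Fin n) → ℝ) :
    partialDeriv i f y = pderiv i f y := rfl

lemma pderiv_congr {f g : EuclideanSpace ℝ (Fin n) → F} (h : f =ᶠ[nhds y] g) :
    pderiv i f y = pderiv i g y := by
  rw [pderiv, h.fderiv_eq, pderiv]

lemma pderiv_const (c : F) : pderiv i (fun _ => c) y = 0 := by
  simp [pderiv]

lemma pderiv_add {f g : EuclideanSpace ℝ (Fin n) → F} (hf : DifferentiableAt ℝ f y)
    (hg : DifferentiableAt ℝ g y) :
    pderiv i (fun z => f z + g z) y = pderiv i f y + pderiv i g y := by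
  rw [pderiv, fderiv_fun_add hf hg]; rfl

lemma pderiv_sub {f g : EuclideanSpace ℝ (Fin n) → F} (hf : DifferentiableAt ℝ f y)
    (hg : DifferentiableAt ℝ g y) :
    pderiv i (fun z => f z - g z) y = pderiv i f y - pderiv i g y := by
  rw [pderiv, fderiv_fun_sub hf hg]; rfl

lemma pderiv_sum {ι : Type*} {s : Finset ι} {f : ι → EuclideanSpace ℝ (Fin n) → F}
    (hf : ∀ a ∈ s, DifferentiableAt ℝ (f a) y) :
    pderiv i (fun z => ∑ a ∈ s, f a z) y = ∑ a ∈ s, pderiv i (f a) y := by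
  rw [pderiv, fderiv_fun_sum hf, sum_apply]; rfl

lemma pderiv_smul {c : EuclideanSpace ℝ (Fin n) → ℝ} {f : EuclideanSpace ℝ (Fin n) → F}
    (hc : DifferentiableAt ℝ c y) (hf : DifferentiableAt ℝ f y) :
    pderiv i (fun z => c z • f z) y = pderiv i c y • f y + c y • pderiv i f y := by
  rw [pderiv, fderiv_fun_smul hc hf, add_comm]; rfl

lemma pderiv_mul {f g : EuclideanSpace ℝ (Fin n) → 𝔸} (hf : DifferentiableAt ℝ f y)
    (hg : DifferentiableAt ℝ g y) :
    pderiv i (fun z => f z * g z) y = pderiv i f y * g y + f y * pderiv i g y := by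
  rw [pderiv, fderiv_fun_mul' hf hg, add_comm]; rfl

lemma pderiv_linearMap [FiniteDimensional ℝ F] {F' : Type*} [NormedAddCommGroup F']
    [NormedSpace ℝ F'] (L : F →ₗ[ℝ] F') {f : EuclideanSpace ℝ (Fin n) → F}
    (hf : DifferentiableAt ℝ f y) : pderiv i (fun z => L (f z)) y = L (pderiv i f y) :=
  DFunLike.congr_fun ((L.toContinuousLinearMap.hasFDerivAt.comp y hf.hasFDerivAt).fderiv) _

lemma contDiffAt_pderiv {f : EuclideanSpace ℝ (Fin n) → F} (hf : ContDiffAt ℝ ∞ f y) :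
    ContDiffAt ℝ ∞ (pderiv i f) y :=
  (hf.fderiv_right (m := ∞) le_rfl).clm_apply contDiffAt_const

lemma pderiv_comm {f : EuclideanSpace ℝ (Fin n) → F} (hf : ContDiffAt ℝ 2 f y) :
    pderiv i (pderiv j f) y = pderiv j (pderiv i f) y := by
  have hdiff : DifferentiableAt ℝ (fderiv ℝ f) y :=
    (hf.fderiv_right (m := 1) (by norm_num)).differentiableAt (by norm_num)
  have hsnd (v w : EuclideanSpace ℝ (Fin n)) :
      fderiv ℝ (fun z => fderiv ℝ f z w) y v = fderiv ℝ (fderiv ℝ f) y v w := by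
    rw [fderiv_clm_apply hdiff (differentiableAt_const w)]
    simp
  unfold pderiv
  rw [hsnd, hsnd]
  exact hf.isSymmSndFDerivAt (by simp) _ _

lemma pderiv_neg (f : EuclideanSpace ℝ (Fin n) → F) :
    pderiv i (fun z => -f z) y = -pderiv i f y := by
  rw [pderiv, fderiv_fun_neg]; rfl

lemma fderiv_apply_eq_sum_pderiv (f : EuclideanSpace ℝ (Fin n) → F)
    (v : EuclideanSpace ℝ (Fin n)) : fderiv ℝ f y v = ∑ i, v i • pderiv i f y := by
  conv_lhs => rw [← (EuclideanSpace.basisFun (Fin n) ℝ).sum_repr v]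
  simp [pderiv]

lemma pderiv_matrix_apply {ι κ : Type*} [Fintype ι] [Fintype κ]
    {X : EuclideanSpace ℝ (Fin n) → Matrix ι κ ℝ} (hX : DifferentiableAt ℝ X y) (a : ι) (b : κ) :
    pderiv i (fun z => X z a b) y = pderiv i X y a b :=
  pderiv_linearMap (Matrix.entryLinearMap ℝ ℝ a b) hX

lemma pderiv_trace {X : EuclideanSpace ℝ (Fin n) → Matrix (Fin n) (Fin n) ℝ}
    (hX : DifferentiableAt ℝ X y) :
    pderiv i (fun z => (X z).trace) y = (pderiv i X y).trace :=
  pderiv_linearMap (Matrix.traceLinearMap (Fin n) ℝ ℝ) hX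

lemma pderiv_transpose {X : EuclideanSpace ℝ (Fin n) → Matrix (Fin n) (Fin n) ℝ}
    (hX : DifferentiableAt ℝ X y) :
    pderiv i (fun z => (X z).transpose) y = (pderiv i X y).transpose :=
  pderiv_linearMap (Matrix.transposeLinearEquiv (Fin n) (Fin n) ℝ ℝ).toLinearMap hX

lemma contDiffAt_linearMap [FiniteDimensional ℝ F] {F' : Type*} [NormedAddCommGroup F']
    [NormedSpace ℝ F'] (L : F →ₗ[ℝ] F') {f : EuclideanSpace ℝ (Fin n) → F} {m : WithTop ℕ∞}
    (hf : ContDiffAt ℝ m f y) : ContDiffAt ℝ m (fun z => L (f z)) y :=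
  L.toContinuousLinearMap.contDiff.contDiffAt.comp y hf

lemma contDiffAt_matrix_apply {ι κ : Type*} [Fintype ι] [Fintype κ] {m : WithTop ℕ∞}
    {X : EuclideanSpace ℝ (Fin n) → Matrix ι κ ℝ} (hX : ContDiffAt ℝ m X y) (a : ι) (b : κ) :
    ContDiffAt ℝ m (fun z => X z a b) y :=
  contDiffAt_linearMap (Matrix.entryLinearMap ℝ ℝ a b) hX

lemma contDiffAt_matrix {ι κ : Type*} [Fintype ι] [Fintype κ] {m : WithTop ℕ∞}
    {X : EuclideanSpace ℝ (Fin n) → Matrix ι κ ℝ}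
    (hX : ∀ a b, ContDiffAt ℝ m (fun z => X z a b) y) : ContDiffAt ℝ m X y := by
  classical
  have hsum : X = fun z => ∑ a, ∑ b, X z a b • Matrix.single a b (1 : ℝ) := by
    funext z
    conv_lhs => rw [Matrix.matrix_eq_sum_single (X z)]
    simp [Matrix.smul_single]
  rw [hsum]
  exact ContDiffAt.sum fun a _ => ContDiffAt.sum fun b _ => (hX a b).smul contDiffAt_const

lemma contDiffAt_matrix_inv {m : WithTop ℕ∞}
    {X : EuclideanSpace ℝ (Fin n) → Matrix (Fin n) (Fin n) ℝ} (hX : ContDiffAt ℝ m X y)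
    (hdet : IsUnit (X y).det) : ContDiffAt ℝ m (fun z => (X z)⁻¹) y := by
  obtain ⟨u, hu⟩ := (Matrix.isUnit_iff_isUnit_det _).2 hdet
  have hinv : ContDiffAt ℝ m Ring.inverse (X y) := hu ▸ contDiffAt_ringInverse ℝ u
  simp only [Matrix.nonsing_inv_eq_ringInverse]
  exact hinv.comp y hX

end Calculus

section Connections

variable {n : ℕ} {𝔸 : Type*} [NormedRing 𝔸] [NormedAlgebra ℝ 𝔸] {y : EuclideanSpace ℝ (Fin n)}

/-- The curvature `F_ij` of the connection `d + Γ` with values in an algebra. -/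
def connCurv (Γ : Fin n → EuclideanSpace ℝ (Fin n) → 𝔸) (i j : Fin n)
    (y : EuclideanSpace ℝ (Fin n)) : 𝔸 :=
  pderiv i (Γ j) y - pderiv j (Γ i) y + (Γ i y * Γ j y - Γ j y * Γ i y)

/-- The derivative of an algebra-valued function along `∂_m` for the connection induced by
`d + Γ`; for matrices, the covariant derivative of a field of endomorphisms. -/
def covDeriv (Γ : Fin n → EuclideanSpace ℝ (Fin n) → 𝔸) (m : Fin n)
    (X : EuclideanSpace ℝ (Fin n) → 𝔸) (y : EuclideanSpace ℝ (Fin n)) : 𝔸 :=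
  pderiv m X y + (Γ m y * X y - X y * Γ m y)

variable {Γ : Fin n → EuclideanSpace ℝ (Fin n) → 𝔸} {X Y : EuclideanSpace ℝ (Fin n) → 𝔸}

lemma connCurv_swap (i j : Fin n) (y : EuclideanSpace ℝ (Fin n)) :
    connCurv Γ i j y = -connCurv Γ j i y := by
  rw [connCurv, connCurv]
  abel

lemma contDiffAt_connCurv (hΓ : ∀ i, ContDiffAt ℝ ∞ (Γ i) y) (i j : Fin n) :
    ContDiffAt ℝ ∞ (connCurv Γ i j) y :=
  ((contDiffAt_pderiv (hΓ j)).sub (contDiffAt_pderiv (hΓ i))).add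
    (((hΓ i).mul (hΓ j)).sub ((hΓ j).mul (hΓ i)))

lemma contDiffAt_covDeriv (hΓ : ∀ i, ContDiffAt ℝ ∞ (Γ i) y) (hX : ContDiffAt ℝ ∞ X y)
    (m : Fin n) : ContDiffAt ℝ ∞ (covDeriv Γ m X) y :=
  (contDiffAt_pderiv hX).add (((hΓ m).mul hX).sub (hX.mul (hΓ m)))

lemma covDeriv_neg (m : Fin n) (X : EuclideanSpace ℝ (Fin n) → 𝔸) :
    covDeriv Γ m (fun z => -X z) y = -covDeriv Γ m X y := by
  rw [covDeriv, covDeriv, pderiv_neg]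
  noncomm_ring

lemma covDeriv_mul (hX : DifferentiableAt ℝ X y) (hY : DifferentiableAt ℝ Y y) (m : Fin n) :
    covDeriv Γ m (fun z => X z * Y z) y = covDeriv Γ m X y * Y y + X y * covDeriv Γ m Y y := by
  simp only [covDeriv]
  rw [pderiv_mul hX hY]
  noncomm_ring

lemma pderiv_mul_sub_mul (hX : DifferentiableAt ℝ X y) (hY : DifferentiableAt ℝ Y y) (i : Fin n) :
    pderiv i (fun z => X z * Y z - Y z * X z) y
      = (pderiv i X y * Y y + X y * pderiv i Y y)
        - (pderiv i Y y * X y + Y y * pderiv i X y) := by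
  rw [pderiv_sub (hX.fun_mul hY) (hY.fun_mul hX), pderiv_mul hX hY, pderiv_mul hY hX]

lemma covDeriv_covDeriv_sub (hΓ : ∀ i, DifferentiableAt ℝ (Γ i) y) (hX : ContDiffAt ℝ ∞ X y)
    (i j : Fin n) :
    covDeriv Γ i (covDeriv Γ j X) y - covDeriv Γ j (covDeriv Γ i X) y
      = connCurv Γ i j y * X y - X y * connCurv Γ i j y := by
  have hX₁ : DifferentiableAt ℝ X y := hX.differentiableAt (by simp)
  have hderiv (a b : Fin n) : pderiv a (covDeriv Γ b X) y = pderiv a (pderiv b X) y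
      + ((pderiv a (Γ b) y * X y + Γ b y * pderiv a X y)
        - (pderiv a X y * Γ b y + X y * pderiv a (Γ b) y)) := by
    rw [← pderiv_mul_sub_mul (hΓ b) hX₁]
    exact pderiv_add ((contDiffAt_pderiv hX).differentiableAt (by simp))
      (((hΓ b).fun_mul hX₁).fun_sub (hX₁.fun_mul (hΓ b)))
  simp only [covDeriv, hderiv, connCurv]
  rw [pderiv_comm (hX.of_le (by norm_cast))]
  noncomm_ring

lemma covDeriv_connCurv_cyclic (hΓ : ∀ i, ContDiffAt ℝ ∞ (Γ i) y) (m i j : Fin n) :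
    covDeriv Γ m (connCurv Γ i j) y + covDeriv Γ i (connCurv Γ j m) y
      + covDeriv Γ j (connCurv Γ m i) y = 0 := by
  have hΓ₁ (a : Fin n) : DifferentiableAt ℝ (Γ a) y := (hΓ a).differentiableAt (by simp)
  have hΓ₂ (a b : Fin n) : DifferentiableAt ℝ (pderiv a (Γ b)) y :=
    (contDiffAt_pderiv (hΓ b)).differentiableAt (by simp)
  have hderiv (a b c : Fin n) : pderiv a (connCurv Γ b c) y
      = pderiv a (pderiv b (Γ c)) y - pderiv a (pderiv c (Γ b)) y
        + ((pderiv a (Γ b) y * Γ c y + Γ b y * pderiv a (Γ c) y)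
          - (pderiv a (Γ c) y * Γ b y + Γ c y * pderiv a (Γ b) y)) := by
    rw [← pderiv_mul_sub_mul (hΓ₁ b) (hΓ₁ c), ← pderiv_sub (hΓ₂ b c) (hΓ₂ c b)]
    exact pderiv_add ((hΓ₂ b c).fun_sub (hΓ₂ c b))
      (((hΓ₁ b).fun_mul (hΓ₁ c)).fun_sub ((hΓ₁ c).fun_mul (hΓ₁ b)))
  have hcomm (a b c : Fin n) : pderiv a (pderiv b (Γ c)) y = pderiv b (pderiv a (Γ c)) y :=
    pderiv_comm ((hΓ c).of_le (by norm_cast))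
  simp only [covDeriv, hderiv, connCurv]
  rw [hcomm m i j, hcomm i j m, hcomm j m i]
  noncomm_ring

end Connections

section AffineConnections

variable {n : ℕ} {y : EuclideanSpace ℝ (Fin n)}

/-- Covariant derivative along `∂_m` of a covariant 2-tensor, for the connection
`∇_i ∂_m = ∑ l, (Γ i)_lm ∂_l`. -/
def covForm (Γ : Fin n → EuclideanSpace ℝ (Fin n) → Matrix (Fin n) (Fin n) ℝ) (m : Fin n)
    (h : EuclideanSpace ℝ (Fin n) → Matrix (Fin n) (Fin n) ℝ) (y : EuclideanSpace ℝ (Fin n)) :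
    Matrix (Fin n) (Fin n) ℝ :=
  pderiv m h y - (Γ m y).transpose * h y - h y * Γ m y

/-- The covariant derivative `∇_m R_ij` of the curvature, as an endomorphism-valued tensor. -/
def covCurv (Γ : Fin n → EuclideanSpace ℝ (Fin n) → Matrix (Fin n) (Fin n) ℝ) (m i j : Fin n)
    (y : EuclideanSpace ℝ (Fin n)) : Matrix (Fin n) (Fin n) ℝ :=
  covDeriv Γ m (connCurv Γ i j) y - ∑ p, Γ m y p i • connCurv Γ p j y
    - ∑ p, Γ m y p j • connCurv Γ i p y

/-- The Ricci tensor `Ric_ik = ∑ j, (R_ji)^j_k` of a connection. -/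
def connRicci (Γ : Fin n → EuclideanSpace ℝ (Fin n) → Matrix (Fin n) (Fin n) ℝ)
    (y : EuclideanSpace ℝ (Fin n)) : Matrix (Fin n) (Fin n) ℝ :=
  Matrix.of fun i k => ∑ j, connCurv Γ j i y j k

variable {Γ : Fin n → EuclideanSpace ℝ (Fin n) → Matrix (Fin n) (Fin n) ℝ}
  {h h' X : EuclideanSpace ℝ (Fin n) → Matrix (Fin n) (Fin n) ℝ}

lemma covForm_congr (hh : h =ᶠ[nhds y] h') (m : Fin n) : covForm Γ m h y = covForm Γ m h' y := by
  rw [covForm, covForm, pderiv_congr hh, hh.eq_of_nhds]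

lemma covForm_transpose (hh : DifferentiableAt ℝ h y) (m : Fin n) :
    covForm Γ m (fun z => (h z).transpose) y = (covForm Γ m h y).transpose := by
  simp only [covForm, pderiv_transpose hh, Matrix.transpose_sub, Matrix.transpose_mul,
    Matrix.transpose_transpose]
  abel

lemma covForm_mul (hh : DifferentiableAt ℝ h y) (hX : DifferentiableAt ℝ X y) (m : Fin n) :
    covForm Γ m (fun z => h z * X z) y = covForm Γ m h y * X y + h y * covDeriv Γ m X y := by
  simp only [covForm, covDeriv, pderiv_mul hh hX]
  noncomm_ring

lemma trace_covDeriv (hX : DifferentiableAt ℝ X y) (m : Fin n) :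
    (covDeriv Γ m X y).trace = pderiv m (fun z => (X z).trace) y := by
  rw [covDeriv, pderiv_trace hX, Matrix.trace_add, Matrix.trace_sub, Matrix.trace_mul_comm,
    sub_self, add_zero]

lemma covForm_covForm_sub (hΓ : ∀ i, DifferentiableAt ℝ (Γ i) y) (hh : ContDiffAt ℝ ∞ h y)
    (i j : Fin n) :
    covForm Γ i (covForm Γ j h) y - covForm Γ j (covForm Γ i h) y
      = -((connCurv Γ i j y).transpose * h y + h y * connCurv Γ i j y) := by
  have hh₁ : DifferentiableAt ℝ h y := hh.differentiableAt (by simp)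
  have hΓt (a : Fin n) : DifferentiableAt ℝ (fun z => (Γ a z).transpose) y :=
    (Matrix.transposeLinearEquiv (Fin n) (Fin n) ℝ ℝ).toLinearMap.toContinuousLinearMap
      |>.differentiableAt.comp y (hΓ a)
  have hderiv (a b : Fin n) : pderiv a (covForm Γ b h) y = pderiv a (pderiv b h) y
      - ((pderiv a (Γ b) y).transpose * h y + (Γ b y).transpose * pderiv a h y)
      - (pderiv a h y * Γ b y + h y * pderiv a (Γ b) y) := by
    have hb : DifferentiableAt ℝ (pderiv b h) y := (contDiffAt_pderiv hh).differentiableAt (by simp)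
    rw [← pderiv_transpose (hΓ b), ← pderiv_mul (hΓt b) hh₁, ← pderiv_mul hh₁ (hΓ b),
      ← pderiv_sub hb ((hΓt b).fun_mul hh₁)]
    exact pderiv_sub (hb.fun_sub ((hΓt b).fun_mul hh₁)) (hh₁.fun_mul (hΓ b))
  simp only [covForm, hderiv, connCurv, Matrix.transpose_add, Matrix.transpose_sub,
    Matrix.transpose_mul]
  rw [pderiv_comm (hh.of_le (by norm_cast))]
  noncomm_ring

lemma transpose_connCurv_mul (hΓ : ∀ i, DifferentiableAt ℝ (Γ i) y) (hh : ContDiffAt ℝ ∞ h y)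
    (hpar : ∀ m, covForm Γ m h =ᶠ[nhds y] fun _ => 0) (i j : Fin n) :
    (connCurv Γ i j y).transpose * h y = -(h y * connCurv Γ i j y) := by
  have hzero (a b : Fin n) : covForm Γ a (covForm Γ b h) y = 0 := by
    rw [covForm_congr (hpar b), covForm, pderiv_const]
    simp
  rw [eq_neg_iff_add_eq_zero, ← neg_eq_zero, ← covForm_covForm_sub hΓ hh, hzero, hzero, sub_zero]

lemma covCurv_swap (m i j : Fin n) (y : EuclideanSpace ℝ (Fin n)) :
    covCurv Γ m i j y = -covCurv Γ m j i y := by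
  have hF : connCurv Γ i j = fun z => -connCurv Γ j i z := funext (connCurv_swap i j)
  simp only [covCurv, hF, covDeriv_neg, connCurv_swap (Γ := Γ) i, connCurv_swap (Γ := Γ) _ j,
    smul_neg, Finset.sum_neg_distrib]
  abel

lemma contDiffAt_connRicci (hΓ : ∀ i, ContDiffAt ℝ ∞ (Γ i) y) :
    ContDiffAt ℝ ∞ (connRicci Γ) y :=
  contDiffAt_matrix fun i k => by
    simp only [connRicci, Matrix.of_apply]
    exact ContDiffAt.sum fun j _ => contDiffAt_matrix_apply (contDiffAt_connCurv hΓ j i) j k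

lemma covForm_connRicci (hΓ : ∀ i, ContDiffAt ℝ ∞ (Γ i) y) (m i k : Fin n) :
    covForm Γ m (connRicci Γ) y i k = ∑ j, covCurv Γ m j i y j k := by
  have hF (j : Fin n) : DifferentiableAt ℝ (connCurv Γ j i) y :=
    (contDiffAt_connCurv hΓ j i).differentiableAt (by simp)
  have hderiv : pderiv m (connRicci Γ) y i k = ∑ j, pderiv m (connCurv Γ j i) y j k := by
    rw [← pderiv_matrix_apply ((contDiffAt_connRicci hΓ).differentiableAt (by simp))]
    simp only [← pderiv_matrix_apply (hF _), connRicci, Matrix.of_apply]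
    exact pderiv_sum fun j _ =>
      (contDiffAt_matrix_apply (contDiffAt_connCurv hΓ j i) j k).differentiableAt (by simp)
  have hfst : ((Γ m y).transpose * connRicci Γ y) i k
      = ∑ j, (∑ p, Γ m y p i • connCurv Γ j p y) j k := by
    simp only [Matrix.mul_apply, Matrix.transpose_apply, connRicci, Matrix.of_apply,
      Matrix.sum_apply, Matrix.smul_apply, smul_eq_mul, Finset.mul_sum]
    rw [Finset.sum_comm]
  have hsnd : (connRicci Γ y * Γ m y) i k = ∑ j, (connCurv Γ j i y * Γ m y) j k := by
    simp only [Matrix.mul_apply, connRicci, Matrix.of_apply, Finset.sum_mul]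
    rw [Finset.sum_comm]
  have hcontracted : ∑ j, (Γ m y * connCurv Γ j i y) j k
      = ∑ j, (∑ p, Γ m y p j • connCurv Γ p i y) j k := by
    simp only [Matrix.mul_apply, Matrix.sum_apply, Matrix.smul_apply, smul_eq_mul]
    rw [Finset.sum_comm]
  simp only [covForm, covCurv, covDeriv, Matrix.sub_apply, Matrix.add_apply,
    Finset.sum_sub_distrib, Finset.sum_add_distrib]
  rw [hderiv, hfst, hsnd, hcontracted]
  ring

section TorsionFree

lemma bianchi_first (hΓ : ∀ i, DifferentiableAt ℝ (Γ i) y)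
    (htors : ∀ᶠ z in nhds y, ∀ i l m, Γ i z l m = Γ m z l i) (i j k l : Fin n) :
    connCurv Γ i j y l k + connCurv Γ j k y l i + connCurv Γ k i y l j = 0 := by
  have hderiv (a b c : Fin n) : pderiv a (Γ b) y l c = pderiv a (Γ c) y l b := by
    rw [← pderiv_matrix_apply (hΓ b), ← pderiv_matrix_apply (hΓ c)]
    exact pderiv_congr (htors.mono fun z hz => hz b l c)
  have hmul (a b c : Fin n) : (Γ a y * Γ b y) l c = (Γ a y * Γ c y) l b := by
    simp only [Matrix.mul_apply]
    exact Finset.sum_congr rfl fun p _ => by rw [htors.self_of_nhds b p c]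
  simp only [connCurv, Matrix.add_apply, Matrix.sub_apply]
  rw [hderiv i j k, hderiv j k i, hderiv k i j, hmul i j k, hmul j k i, hmul k i j]
  ring

lemma bianchi_second (hΓ : ∀ i, ContDiffAt ℝ ∞ (Γ i) y)
    (htors : ∀ i l m, Γ i y l m = Γ m y l i) (m i j : Fin n) :
    covCurv Γ m i j y + covCurv Γ i j m y + covCurv Γ j m i y = 0 := by
  have hcancel (a b c : Fin n) : ∑ p, Γ a y p b • connCurv Γ p c y
      = -∑ p, Γ b y p a • connCurv Γ c p y := by
    rw [← Finset.sum_neg_distrib]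
    exact Finset.sum_congr rfl fun p _ => by rw [htors a p b, connCurv_swap p c, smul_neg]
  simp only [covCurv]
  rw [hcancel m i j, hcancel i j m, hcancel j m i, ← covDeriv_connCurv_cyclic hΓ m i j]
  abel

lemma sum_covCurv_eq_covForm_sub (hΓ : ∀ i, ContDiffAt ℝ ∞ (Γ i) y)
    (htors : ∀ i l m, Γ i y l m = Γ m y l i) (j k l : Fin n) :
    ∑ m, covCurv Γ m k l y m j
      = covForm Γ k (connRicci Γ) y l j - covForm Γ l (connRicci Γ) y k j := by
  rw [covForm_connRicci hΓ, covForm_connRicci hΓ, ← Finset.sum_sub_distrib]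
  refine Finset.sum_congr rfl fun m _ => ?_
  have hbianchi := congrFun₂ (bianchi_second hΓ htors m k l) m j
  rw [covCurv_swap k l m] at hbianchi
  simp only [Matrix.add_apply, Matrix.neg_apply, Matrix.zero_apply] at hbianchi
  linarith

end TorsionFree

end AffineConnections

section LeviCivita

variable {n : ℕ} {U : Set (EuclideanSpace ℝ (Fin n))} {y : EuclideanSpace ℝ (Fin n)}
  {G : EuclideanSpace ℝ (Fin n) → Matrix (Fin n) (Fin n) ℝ}

/-- `G` is a smooth pseudo-Riemannian metric on the open set `U`. -/
structure IsMetricOn (U : Set (EuclideanSpace ℝ (Fin n)))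
    (G : EuclideanSpace ℝ (Fin n) → Matrix (Fin n) (Fin n) ℝ) : Prop where
  isOpen : IsOpen U
  smooth : ContDiffOn ℝ ∞ G U
  symm : ∀ y ∈ U, (G y).IsSymm
  det_ne : ∀ y ∈ U, (G y).det ≠ 0

/-- The matrix `(Γ_i)_lm = Γ^l_im` of the Levi-Civita connection. -/
def leviCivita (G : EuclideanSpace ℝ (Fin n) → Matrix (Fin n) (Fin n) ℝ) (i : Fin n)
    (y : EuclideanSpace ℝ (Fin n)) : Matrix (Fin n) (Fin n) ℝ :=
  Matrix.of fun l m => christoffel G i m l y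

/-- The Christoffel symbols of the first kind `g_lp Γ^p_im`, as matrices in `l` and `m`. -/
def christoffelFirst (G : EuclideanSpace ℝ (Fin n) → Matrix (Fin n) (Fin n) ℝ) (i : Fin n)
    (y : EuclideanSpace ℝ (Fin n)) : Matrix (Fin n) (Fin n) ℝ :=
  Matrix.of fun l m => (1 / 2) * (pderiv i G y m l + pderiv m G y i l - pderiv l G y i m)

lemma curvature_swap_left (i j k l : Fin n) (y : EuclideanSpace ℝ (Fin n)) :
    curvature G i j k l y = -curvature G j i k l y := by
  simp only [curvature, curvatureUp, ← Finset.sum_neg_distrib, ← mul_neg, Finset.sum_sub_distrib]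
  exact Finset.sum_congr rfl fun m _ => by ring

namespace IsMetricOn

variable (hG : IsMetricOn U G)
include hG

lemma mono {V : Set (EuclideanSpace ℝ (Fin n))} (hV : IsOpen V) (hVU : V ⊆ U) :
    IsMetricOn V G :=
  ⟨hV, hG.smooth.mono hVU, fun z hz => hG.symm z (hVU hz), fun z hz => hG.det_ne z (hVU hz)⟩

lemma mem_nhds (hy : y ∈ U) : U ∈ nhds y := hG.isOpen.mem_nhds hy

lemma eventually_of_forall_mem {P : EuclideanSpace ℝ (Fin n) → Prop} (hy : y ∈ U)
    (hP : ∀ z ∈ U, P z) : ∀ᶠ z in nhds y, P z :=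
  Filter.mem_of_superset (hG.mem_nhds hy) hP

lemma isUnit_det (hy : y ∈ U) : IsUnit (G y).det := (hG.det_ne y hy).isUnit

lemma contDiffAt (hy : y ∈ U) : ContDiffAt ℝ ∞ G y := hG.smooth.contDiffAt (hG.mem_nhds hy)

lemma differentiableAt (hy : y ∈ U) : DifferentiableAt ℝ G y :=
  (hG.contDiffAt hy).differentiableAt (by simp)

lemma contDiffAt_inv (hy : y ∈ U) : ContDiffAt ℝ ∞ (fun z => (G z)⁻¹) y :=
  contDiffAt_matrix_inv (hG.contDiffAt hy) (hG.isUnit_det hy)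

lemma inv_symm (hy : y ∈ U) : ((G y)⁻¹).IsSymm := by
  rw [Matrix.IsSymm, Matrix.transpose_nonsing_inv, (hG.symm y hy).eq]

lemma pderiv_symm (hy : y ∈ U) (k : Fin n) : (pderiv k G y).IsSymm := by
  rw [Matrix.IsSymm, ← pderiv_transpose (hG.differentiableAt hy)]
  exact pderiv_congr (hG.eventually_of_forall_mem hy hG.symm)

lemma leviCivita_eq (hy : y ∈ U) (i : Fin n) :
    leviCivita G i y = (G y)⁻¹ * christoffelFirst G i y := by
  ext l m
  simp only [leviCivita, christoffelFirst, christoffel, partialDeriv_eq_pderiv,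
    pderiv_matrix_apply (hG.differentiableAt hy), Matrix.of_apply, Matrix.mul_apply,
    Finset.mul_sum]
  exact Finset.sum_congr rfl fun k _ => by ring

lemma mul_leviCivita (hy : y ∈ U) (i : Fin n) :
    G y * leviCivita G i y = christoffelFirst G i y := by
  rw [hG.leviCivita_eq hy, ← mul_assoc, Matrix.mul_nonsing_inv _ (hG.isUnit_det hy), one_mul]

lemma contDiffAt_leviCivita (hy : y ∈ U) (i : Fin n) : ContDiffAt ℝ ∞ (leviCivita G i) y := by
  have hentry (a b c : Fin n) : ContDiffAt ℝ ∞ (fun z => pderiv a G z b c) y :=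
    contDiffAt_matrix_apply (contDiffAt_pderiv (hG.contDiffAt hy)) b c
  have hfirst : ContDiffAt ℝ ∞ (christoffelFirst G i) y := contDiffAt_matrix fun l m =>
    contDiffAt_const.mul (((hentry i m l).add (hentry m i l)).sub (hentry l i m))
  exact ((hG.contDiffAt_inv hy).mul hfirst).congr_of_eventuallyEq
    (hG.eventually_of_forall_mem hy fun z hz => hG.leviCivita_eq hz i)

lemma differentiableAt_leviCivita (hy : y ∈ U) (i : Fin n) :
    DifferentiableAt ℝ (leviCivita G i) y :=
  (hG.contDiffAt_leviCivita hy i).differentiableAt (by simp)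

lemma contDiffAt_connCurv (hy : y ∈ U) (i j : Fin n) :
    ContDiffAt ℝ ∞ (connCurv (leviCivita G) i j) y :=
  HarmonicCurvature.contDiffAt_connCurv (hG.contDiffAt_leviCivita hy) i j

lemma leviCivita_symm (hy : y ∈ U) (i l m : Fin n) :
    leviCivita G i y l m = leviCivita G m y l i := by
  simp only [hG.leviCivita_eq hy, Matrix.mul_apply, christoffelFirst, Matrix.of_apply]
  refine Finset.sum_congr rfl fun k _ => ?_
  rw [(hG.pderiv_symm hy k).apply m i]
  ring

lemma covForm_metric (hy : y ∈ U) (k : Fin n) : covForm (leviCivita G) k G y = 0 := by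
  have hadj : (leviCivita G k y).transpose * G y = (christoffelFirst G k y).transpose := by
    rw [← hG.mul_leviCivita hy, Matrix.transpose_mul, (hG.symm y hy).eq]
  rw [covForm, hadj, hG.mul_leviCivita hy]
  ext l j
  simp only [christoffelFirst, Matrix.of_apply, Matrix.sub_apply, Matrix.transpose_apply,
    Matrix.zero_apply]
  rw [(hG.pderiv_symm hy k).apply l j]
  ring

lemma leviCivita_unique (hy : y ∈ U) {C : Fin n → Matrix (Fin n) (Fin n) ℝ}
    (hsymm : ∀ i l m, C i l m = C m l i)
    (hcompat : ∀ k, pderiv k G y = (C k).transpose * G y + G y * C k) (i : Fin n) :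
    leviCivita G i y = C i := by
  have hderiv (k a b : Fin n) : pderiv k G y a b = (G y * C k) b a + (G y * C k) a b := by
    have hadj : (C k).transpose * G y = (G y * C k).transpose := by
      rw [Matrix.transpose_mul, (hG.symm y hy).eq]
    rw [hcompat, hadj, Matrix.add_apply, Matrix.transpose_apply]
  have hlower (a b c : Fin n) : (G y * C a) b c = (G y * C c) b a := by
    simp only [Matrix.mul_apply]
    exact Finset.sum_congr rfl fun p _ => by rw [hsymm]
  have hfirst : christoffelFirst G i y = G y * C i := by
    ext l m
    simp only [christoffelFirst, Matrix.of_apply, hderiv]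
    rw [hlower l m i, hlower m i l, hlower m l i, hlower l i m]
    ring
  rw [hG.leviCivita_eq hy, hfirst, ← mul_assoc, Matrix.nonsing_inv_mul _ (hG.isUnit_det hy),
    one_mul]

lemma curvatureUp_eq (hy : y ∈ U) (i j k l : Fin n) :
    curvatureUp G i j k l y = connCurv (leviCivita G) i j y l k := by
  simp only [connCurv, Matrix.add_apply, Matrix.sub_apply, Matrix.mul_apply,
    ← pderiv_matrix_apply (hG.differentiableAt_leviCivita hy _), curvatureUp,
    Finset.sum_sub_distrib]
  rfl

lemma curvature_eq (hy : y ∈ U) (i j k l : Fin n) :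
    curvature G i j k l y = (G y * connCurv (leviCivita G) i j y) k l := by
  simp only [curvature, hG.curvatureUp_eq hy, Matrix.mul_apply]

lemma curvature_swap_right (hy : y ∈ U) (i j k l : Fin n) :
    curvature G i j k l y = -curvature G i j l k y := by
  have hskew := transpose_connCurv_mul (hG.differentiableAt_leviCivita hy) (hG.contDiffAt hy)
    (fun m => hG.eventually_of_forall_mem hy fun z hz => hG.covForm_metric hz m) i j
  rw [hG.curvature_eq hy, hG.curvature_eq hy, ← Matrix.neg_apply, ← hskew,
    ← Matrix.transpose_apply (_ * _) l k, Matrix.transpose_mul, (hG.symm y hy).eq]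

lemma curvature_bianchi (hy : y ∈ U) (i j k l : Fin n) :
    curvature G i j l k y + curvature G j k l i y + curvature G k i l j y = 0 := by
  have htors := hG.eventually_of_forall_mem hy fun z hz => hG.leviCivita_symm hz
  simp only [hG.curvature_eq hy, Matrix.mul_apply, ← Finset.sum_add_distrib, ← mul_add,
    bianchi_first (hG.differentiableAt_leviCivita hy) htors, mul_zero, Finset.sum_const_zero]

lemma curvature_pair (hy : y ∈ U) (i j k l : Fin n) :
    curvature G i j k l y = curvature G k l i j y := by
  have bianchi := hG.curvature_bianchi hy
  have right := hG.curvature_swap_right hy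
  have left := fun a b c d => curvature_swap_left (G := G) a b c d y
  linarith [bianchi i j k l, bianchi j k l i, bianchi k l i j, bianchi l i j k,
    right i j k l, right j k i l, right k i j l, right j k l i, right k l i j, right l j k i,
    right k l j i, right l i k j, right i k l j, right l i j k, right i j l k, right j l i k,
    left i k j l, left i k l j, left j l i k, left j l k i, left l j k i, left l i j k,
    left j k i l, left k i j l, left k i l j, left l j i k, left i j k l, left k l i j]

lemma curvature_swap_both (hy : y ∈ U) (i j k l : Fin n) :
    curvature G i j k l y = curvature G j i l k y := by
  rw [curvature_swap_left, hG.curvature_swap_right hy j i, neg_neg]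

lemma sum_inv_mul_mul (hy : y ∈ U) (Z : Fin n → Matrix (Fin n) (Fin n) ℝ) (k : Fin n) :
    ∑ j, ∑ l, (G y)⁻¹ j l * (G y * Z j) l k = ∑ j, Z j j k := by
  refine Finset.sum_congr rfl fun j _ => ?_
  rw [← Matrix.mul_apply, ← mul_assoc, Matrix.nonsing_inv_mul _ (hG.isUnit_det hy), one_mul]

lemma ricci_eq (hy : y ∈ U) (i k : Fin n) : ricci G i k y = connRicci (leviCivita G) y i k := by
  rw [connRicci, Matrix.of_apply, ← hG.sum_inv_mul_mul hy, ricci]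
  refine Finset.sum_congr rfl fun j _ => Finset.sum_congr rfl fun l _ => ?_
  rw [hG.curvature_swap_both hy, hG.curvature_eq hy]

lemma connRicci_symm (hy : y ∈ U) : (connRicci (leviCivita G) y).IsSymm := by
  ext i k
  rw [Matrix.transpose_apply, ← hG.ricci_eq hy, ← hG.ricci_eq hy, ricci, ricci, Finset.sum_comm]
  refine Finset.sum_congr rfl fun j _ => Finset.sum_congr rfl fun l _ => ?_
  rw [hG.curvature_pair hy, (hG.inv_symm hy).apply]

lemma contDiffAt_connRicci (hy : y ∈ U) : ContDiffAt ℝ ∞ (connRicci (leviCivita G)) y :=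
  HarmonicCurvature.contDiffAt_connRicci (hG.contDiffAt_leviCivita hy)

lemma covForm_metric_mul (hy : y ∈ U) {X : EuclideanSpace ℝ (Fin n) → Matrix (Fin n) (Fin n) ℝ}
    (hX : DifferentiableAt ℝ X y) (m : Fin n) :
    covForm (leviCivita G) m (fun z => G z * X z) y = G y * covDeriv (leviCivita G) m X y := by
  rw [covForm_mul (hG.differentiableAt hy) hX, hG.covForm_metric hy, zero_mul, zero_add]

lemma isSymm_mul_covDeriv (hy : y ∈ U)
    {X : EuclideanSpace ℝ (Fin n) → Matrix (Fin n) (Fin n) ℝ} (hX : DifferentiableAt ℝ X y)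
    (hsymm : ∀ z ∈ U, (G z * X z).IsSymm) (m : Fin n) :
    (G y * covDeriv (leviCivita G) m X y).IsSymm := by
  rw [Matrix.IsSymm, ← hG.covForm_metric_mul hy hX,
    ← covForm_transpose ((hG.differentiableAt hy).fun_mul hX)]
  exact covForm_congr (hG.eventually_of_forall_mem hy hsymm) m

end IsMetricOn

end LeviCivita

section Divergence

variable {n : ℕ} {U : Set (EuclideanSpace ℝ (Fin n))} {y : EuclideanSpace ℝ (Fin n)}
  {G : EuclideanSpace ℝ (Fin n) → Matrix (Fin n) (Fin n) ℝ}

namespace IsMetricOn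

variable (hG : IsMetricOn U G)
include hG

lemma nablaCurvature_eq (hy : y ∈ U) (m i j k l : Fin n) :
    nablaCurvature G m i j k l y = (G y * covCurv (leviCivita G) m i j y) k l := by
  have hF : DifferentiableAt ℝ (connCurv (leviCivita G) i j) y :=
    (hG.contDiffAt_connCurv hy i j).differentiableAt (by simp)
  have hderiv : partialDeriv m (curvature G i j k l) y
      = pderiv m (fun z => G z * connCurv (leviCivita G) i j z) y k l := by
    rw [← pderiv_matrix_apply ((hG.differentiableAt hy).fun_mul hF)]
    exact pderiv_congr (hG.eventually_of_forall_mem hy fun z hz => hG.curvature_eq hz i j k l)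
  have hsmul (c : Fin n → ℝ) (F : Fin n → Matrix (Fin n) (Fin n) ℝ) :
      ∑ p, c p * (G y * F p) k l = (G y * ∑ p, c p • F p) k l := by
    simp only [Finset.mul_sum, Matrix.sum_apply, mul_smul_comm, Matrix.smul_apply, smul_eq_mul]
  have hfst (h : Matrix (Fin n) (Fin n) ℝ) :
      ((leviCivita G m y).transpose * h) k l = ∑ p, leviCivita G m y p k * h p l := rfl
  have hsnd (h : Matrix (Fin n) (Fin n) ℝ) :
      (h * leviCivita G m y) k l = ∑ p, leviCivita G m y p l * h k p := by
    simp only [Matrix.mul_apply, mul_comm]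
  calc nablaCurvature G m i j k l y
      = (covForm (leviCivita G) m (fun z => G z * connCurv (leviCivita G) i j z) y
          - G y * ∑ p, leviCivita G m y p i • connCurv (leviCivita G) p j y
          - G y * ∑ p, leviCivita G m y p j • connCurv (leviCivita G) i p y) k l := by
        simp only [nablaCurvature, hderiv, covForm, Matrix.sub_apply, ← hsmul, hfst, hsnd,
          Finset.sum_add_distrib, ← hG.curvature_eq hy]
        simp only [leviCivita, Matrix.of_apply]
        ring
    _ = (G y * covCurv (leviCivita G) m i j y) k l := by
        rw [hG.covForm_metric_mul hy hF, covCurv, mul_sub, mul_sub]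

lemma nablaCurvature_pair (hy : y ∈ U) (m i j k l : Fin n) :
    nablaCurvature G m i j k l y = nablaCurvature G m k l i j y := by
  have hderiv : partialDeriv m (curvature G i j k l) y = partialDeriv m (curvature G k l i j) y :=
    pderiv_congr (hG.eventually_of_forall_mem hy fun z hz => hG.curvature_pair hz i j k l)
  rw [nablaCurvature, nablaCurvature, hderiv]
  congr 1
  refine Finset.sum_congr rfl fun p _ => ?_
  rw [hG.curvature_pair hy p j k l, hG.curvature_pair hy i p k l, hG.curvature_pair hy i j p l,
    hG.curvature_pair hy i j k p]
  ring

lemma nablaCurvature_swap_left (hy : y ∈ U) (m i j k l : Fin n) :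
    nablaCurvature G m i j k l y = -nablaCurvature G m j i k l y := by
  rw [hG.nablaCurvature_eq hy, hG.nablaCurvature_eq hy, covCurv_swap, mul_neg, Matrix.neg_apply]

lemma nablaCurvature_swap_both (hy : y ∈ U) (m i j k l : Fin n) :
    nablaCurvature G m i j k l y = nablaCurvature G m j i l k y := by
  rw [hG.nablaCurvature_swap_left hy, hG.nablaCurvature_pair hy, hG.nablaCurvature_swap_left hy,
    neg_neg, hG.nablaCurvature_pair hy]

lemma divCurvature_eq (hy : y ∈ U) (j k l : Fin n) :
    divCurvature G j k l y = covForm (leviCivita G) k (connRicci (leviCivita G)) y l j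
      - covForm (leviCivita G) l (connRicci (leviCivita G)) y k j := by
  rw [← sum_covCurv_eq_covForm_sub (hG.contDiffAt_leviCivita hy) (hG.leviCivita_symm hy),
    ← hG.sum_inv_mul_mul hy (fun m => covCurv (leviCivita G) m k l y), divCurvature]
  refine Finset.sum_congr rfl fun m _ => Finset.sum_congr rfl fun i _ => ?_
  rw [hG.nablaCurvature_pair hy, hG.nablaCurvature_eq hy]

lemma sum_inv_mul_divCurvature (hy : y ∈ U) (k : Fin n) :
    ∑ j, ∑ l, (G y)⁻¹ j l * divCurvature G j k l y
      = ∑ m, ∑ i, (G y)⁻¹ m i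
          * covForm (leviCivita G) m (connRicci (leviCivita G)) y i k := by
  have hcontract (m i : Fin n) : covForm (leviCivita G) m (connRicci (leviCivita G)) y i k
      = ∑ j, ∑ l, (G y)⁻¹ j l * nablaCurvature G m i j k l y := by
    rw [covForm_connRicci (hG.contDiffAt_leviCivita hy), ← hG.sum_inv_mul_mul hy]
    refine Finset.sum_congr rfl fun j _ => Finset.sum_congr rfl fun l _ => ?_
    rw [hG.nablaCurvature_swap_both hy, hG.nablaCurvature_eq hy]
  simp only [hcontract, divCurvature, Finset.mul_sum, ← Fintype.sum_prod_type']
  exact Fintype.sum_equiv ((Equiv.prodAssoc _ _ _).symm.trans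
    ((Equiv.prodComm _ _).trans (Equiv.prodAssoc _ _ _))) _ _ fun _ => mul_left_comm _ _ _

end IsMetricOn

end Divergence

section SecondDerivativeTest

lemma deriv_deriv_nonpos_of_isLocalMax {f : ℝ → ℝ} {t : ℝ} (hf : ContinuousAt f t)
    (hmax : IsLocalMax f t) : deriv (deriv f) t ≤ 0 := by
  by_contra! hpos
  -- a critical point with positive second derivative is also a local minimum
  have hmin : IsLocalMin f t := isLocalMin_of_deriv_deriv_pos hpos hmax.deriv_eq_zero hf
  have hconst : f =ᶠ[nhds t] fun _ => f t := by
    filter_upwards [hmax, hmin] with s hle hge using le_antisymm hle hge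
  have hderiv : deriv f =ᶠ[nhds t] fun _ => 0 := by
    filter_upwards [hconst.eventuallyEq_nhds] with s hs
    rw [hs.deriv_eq, deriv_const]
  exact hpos.ne' (by rw [hderiv.deriv_eq, deriv_const])

lemma eventually_differentiableAt {E F : Type*} [NormedAddCommGroup E] [NormedSpace ℝ E]
    [NormedAddCommGroup F] [NormedSpace ℝ F] {f : E → F} {y : E} (hf : ContDiffAt ℝ ∞ f y) :
    ∀ᶠ z in nhds y, DifferentiableAt ℝ f z :=
  ((hf.of_le (by norm_cast) : ContDiffAt ℝ 1 f y).eventually (by simp)).mono fun _ hz =>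
    hz.differentiableAt (by simp)

lemma pderiv_pderiv_nonpos_of_isLocalMax {n : ℕ} {f : EuclideanSpace ℝ (Fin n) → ℝ}
    {y : EuclideanSpace ℝ (Fin n)} (hf : ContDiffAt ℝ ∞ f y) (hmax : IsLocalMax f y)
    (i : Fin n) : pderiv i (pderiv i f) y ≤ 0 := by
  set γ : ℝ → EuclideanSpace ℝ (Fin n) := fun t => y + t • EuclideanSpace.single i 1
  have hγ_zero : γ 0 = y := by simp [γ]
  have hγ_tendsto : Filter.Tendsto γ (nhds 0) (nhds y) :=
    (by fun_prop : Continuous γ).tendsto' 0 y hγ_zero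
  have hderiv {φ : EuclideanSpace ℝ (Fin n) → ℝ} {t : ℝ} (hφ : DifferentiableAt ℝ φ (γ t)) :
      HasDerivAt (φ ∘ γ) (pderiv i φ (γ t)) t :=
    hφ.hasFDerivAt.comp_hasDerivAt t
      ((((hasDerivAt_id t).smul_const _).const_add y).congr_deriv (one_smul _ _))
  have hfirst : deriv (f ∘ γ) =ᶠ[nhds 0] pderiv i f ∘ γ := by
    filter_upwards [hγ_tendsto.eventually (eventually_differentiableAt hf)] with t ht
      using (hderiv ht).deriv
  have hsecond : deriv (deriv (f ∘ γ)) 0 = pderiv i (pderiv i f) y := by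
    have hpderiv := (contDiffAt_pderiv (i := i) hf).differentiableAt (by simp)
    rw [hfirst.deriv_eq, (hderiv (by rwa [hγ_zero])).deriv, hγ_zero]
  have hcont : ContinuousAt (f ∘ γ) 0 :=
    (hderiv (by simpa only [hγ_zero] using hf.differentiableAt (by simp))).continuousAt
  rw [← hsecond]
  refine deriv_deriv_nonpos_of_isLocalMax hcont ?_
  filter_upwards [hγ_tendsto.eventually hmax] with t ht
  simpa only [Function.comp_apply, hγ_zero] using ht

end SecondDerivativeTest

section Hessian

variable {n : ℕ} {y : EuclideanSpace ℝ (Fin n)}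
  {Γ : Fin n → EuclideanSpace ℝ (Fin n) → Matrix (Fin n) (Fin n) ℝ}
  {X : EuclideanSpace ℝ (Fin n) → Matrix (Fin n) (Fin n) ℝ}

/-- The second covariant derivative `∇²_lm X` of a field of endomorphisms of the tangent spaces;
the last term differentiates the index `m`. -/
def hessEnd (Γ : Fin n → EuclideanSpace ℝ (Fin n) → Matrix (Fin n) (Fin n) ℝ) (l m : Fin n)
    (X : EuclideanSpace ℝ (Fin n) → Matrix (Fin n) (Fin n) ℝ) (y : EuclideanSpace ℝ (Fin n)) :
    Matrix (Fin n) (Fin n) ℝ :=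
  covDeriv Γ l (covDeriv Γ m X) y - ∑ p, Γ l y p m • covDeriv Γ p X y

lemma hessEnd_sub_hessEnd (hΓ : ∀ i, DifferentiableAt ℝ (Γ i) y)
    (htors : ∀ i l m, Γ i y l m = Γ m y l i) (hX : ContDiffAt ℝ ∞ X y) (l m : Fin n) :
    hessEnd Γ l m X y - hessEnd Γ m l X y = connCurv Γ l m y * X y - X y * connCurv Γ l m y := by
  rw [← covDeriv_covDeriv_sub hΓ hX, hessEnd, hessEnd]
  simp only [fun p => htors l p m]
  abel

lemma trace_hessEnd (hΓ : ∀ i, ContDiffAt ℝ ∞ (Γ i) y) (hX : ContDiffAt ℝ ∞ X y)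
    (htrace : ∀ᶠ z in nhds y, ∀ m, (covDeriv Γ m X z).trace = 0) (l m : Fin n) :
    (hessEnd Γ l m X y).trace = 0 := by
  rw [hessEnd, Matrix.trace_sub, Matrix.trace_sum,
    trace_covDeriv ((contDiffAt_covDeriv hΓ hX m).differentiableAt (by simp)),
    pderiv_congr (htrace.mono fun z hz => hz m), pderiv_const]
  simp only [Matrix.trace_smul, htrace.self_of_nhds, smul_zero, Finset.sum_const_zero, sub_zero]

lemma hessEnd_apply_swap (hΓ : ∀ i, ContDiffAt ℝ ∞ (Γ i) y) (hX : ContDiffAt ℝ ∞ X y)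
    (hswap : ∀ᶠ z in nhds y, ∀ m i j, covDeriv Γ m X z i j = covDeriv Γ j X z i m)
    (l m i j : Fin n) : hessEnd Γ l m X y i j = hessEnd Γ l j X y i m := by
  have hswap_y := hswap.self_of_nhds
  have hderiv : pderiv l (covDeriv Γ m X) y i j = pderiv l (covDeriv Γ j X) y i m := by
    have hdiff (a : Fin n) := (contDiffAt_covDeriv hΓ hX a).differentiableAt (by simp)
    rw [← pderiv_matrix_apply (hdiff m), ← pderiv_matrix_apply (hdiff j)]
    exact pderiv_congr (hswap.mono fun z hz => hz m i j)
  have hleft : (Γ l y * covDeriv Γ m X y) i j = (Γ l y * covDeriv Γ j X y) i m := by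
    simp only [Matrix.mul_apply, hswap_y m _ j]
  have hright (a b : Fin n) :
      (covDeriv Γ a X y * Γ l y) i b = ∑ p, Γ l y p b * covDeriv Γ p X y i a := by
    rw [Matrix.mul_apply]
    exact Finset.sum_congr rfl fun p _ => by rw [hswap_y a, mul_comm]
  have hexpand (a b : Fin n) : hessEnd Γ l a X y i b = pderiv l (covDeriv Γ a X) y i b
      + ((Γ l y * covDeriv Γ a X y) i b - ∑ p, Γ l y p b * covDeriv Γ p X y i a)
      - ∑ p, Γ l y p a * covDeriv Γ p X y i b := by
    simp only [hessEnd, covDeriv.eq_1 Γ l, ← hright, Matrix.sub_apply, Matrix.add_apply,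
      Matrix.sum_apply, Matrix.smul_apply, smul_eq_mul]
  rw [hexpand, hexpand, hderiv, hleft]
  ring

lemma pderiv_trace_mul_self (hX : DifferentiableAt ℝ X y) (m : Fin n) :
    pderiv m (fun z => (X z * X z).trace) y = 2 * (X y * covDeriv Γ m X y).trace := by
  rw [← trace_covDeriv (Γ := Γ) (hX.fun_mul hX), covDeriv_mul hX hX, Matrix.trace_add,
    Matrix.trace_mul_comm, two_mul]

lemma pderiv_pderiv_trace_mul_self (hΓ : ∀ i, ContDiffAt ℝ ∞ (Γ i) y) (hX : ContDiffAt ℝ ∞ X y)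
    (m : Fin n) :
    pderiv m (pderiv m fun z => (X z * X z).trace) y
      = 2 * ((covDeriv Γ m X y * covDeriv Γ m X y).trace
        + (X y * covDeriv Γ m (covDeriv Γ m X) y).trace) := by
  have hX₁ : DifferentiableAt ℝ X y := hX.differentiableAt (by simp)
  have hdiff : DifferentiableAt ℝ (covDeriv Γ m X) y :=
    (contDiffAt_covDeriv hΓ hX m).differentiableAt (by simp)
  have hfirst : (pderiv m fun z => (X z * X z).trace)
      =ᶠ[nhds y] fun z => 2 * (X z * covDeriv Γ m X z).trace :=
    (eventually_differentiableAt hX).mono fun z hz => pderiv_trace_mul_self hz m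
  have htrace : DifferentiableAt ℝ (fun z => (X z * covDeriv Γ m X z).trace) y :=
    (Matrix.traceLinearMap (Fin n) ℝ ℝ).toContinuousLinearMap.differentiableAt.comp y
      (hX₁.fun_mul hdiff)
  rw [pderiv_congr hfirst, pderiv_mul (differentiableAt_const _) htrace, pderiv_const, zero_mul,
    zero_add, ← trace_covDeriv (Γ := Γ) (hX₁.fun_mul hdiff), covDeriv_mul hX₁ hdiff,
    Matrix.trace_add]

end Hessian

section Codazzi

variable {n : ℕ} {U : Set (EuclideanSpace ℝ (Fin n))} {y : EuclideanSpace ℝ (Fin n)}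
  {G H : EuclideanSpace ℝ (Fin n) → Matrix (Fin n) (Fin n) ℝ} {ρ : Fin n → ℝ}

/-- A self-adjoint field of endomorphisms which is a Codazzi tensor of constant trace for the
metric `G`. -/
structure IsCodazziOn (U : Set (EuclideanSpace ℝ (Fin n)))
    (G H : EuclideanSpace ℝ (Fin n) → Matrix (Fin n) (Fin n) ℝ) : Prop where
  contDiffAt : ∀ z ∈ U, ContDiffAt ℝ ∞ H z
  isSymm_mul : ∀ z ∈ U, (G z * H z).IsSymm
  covDeriv_swap : ∀ z ∈ U, ∀ m i j,
    covDeriv (leviCivita G) m H z i j = covDeriv (leviCivita G) j H z i m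
  trace_covDeriv : ∀ z ∈ U, ∀ m, (covDeriv (leviCivita G) m H z).trace = 0

namespace IsCodazziOn

variable (hH : IsCodazziOn U G H) (hG : IsMetricOn U G) (hy : y ∈ U)
include hH hG hy

lemma isSymm_mul_covDeriv (m : Fin n) : (G y * covDeriv (leviCivita G) m H y).IsSymm :=
  hG.isSymm_mul_covDeriv hy ((hH.contDiffAt y hy).differentiableAt (by simp)) hH.isSymm_mul m

lemma isSymm_mul_hessEnd (l m : Fin n) : (G y * hessEnd (leviCivita G) l m H y).IsSymm := by
  have hsecond := hG.isSymm_mul_covDeriv hy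
    ((contDiffAt_covDeriv (hG.contDiffAt_leviCivita hy) (hH.contDiffAt y hy) m).differentiableAt
      (by simp)) (fun z hz => hH.isSymm_mul_covDeriv hG hz m) l
  have hfirst (p : Fin n) := hH.isSymm_mul_covDeriv hG hy p
  rw [hessEnd, mul_sub, Finset.mul_sum]
  refine hsecond.sub ?_
  simp only [Matrix.IsSymm, Matrix.transpose_sum, mul_smul_comm, Matrix.transpose_smul,
    (hfirst _).eq]

lemma hessEnd_apply_swap (l m i j : Fin n) :
    hessEnd (leviCivita G) l m H y i j = hessEnd (leviCivita G) l j H y i m :=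
  HarmonicCurvature.hessEnd_apply_swap (hG.contDiffAt_leviCivita hy) (hH.contDiffAt y hy)
    (hG.eventually_of_forall_mem hy hH.covDeriv_swap) l m i j

lemma laplacian_eq (h1 : G y = 1) (i j : Fin n) :
    ∑ l, hessEnd (leviCivita G) l l H y i j
      = ∑ l, (connCurv (leviCivita G) l j y * H y - H y * connCurv (leviCivita G) l j y) i l := by
  have hsymm (l m : Fin n) : (hessEnd (leviCivita G) l m H y).IsSymm := by
    simpa only [h1, one_mul] using hH.isSymm_mul_hessEnd hG hy l m
  have htrace : ∑ l, hessEnd (leviCivita G) j l H y i l = 0 := calc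
    ∑ l, hessEnd (leviCivita G) j l H y i l = (hessEnd (leviCivita G) j i H y).trace :=
      Finset.sum_congr rfl fun l _ => by
        rw [← (hsymm j l).apply, hH.hessEnd_apply_swap hG hy, Matrix.diag_apply]
    _ = 0 := trace_hessEnd (hG.contDiffAt_leviCivita hy) (hH.contDiffAt y hy)
      (hG.eventually_of_forall_mem hy hH.trace_covDeriv) j i
  rw [← sub_zero (∑ l, hessEnd _ l l H y i j), ← htrace, ← Finset.sum_sub_distrib]
  refine Finset.sum_congr rfl fun l _ => ?_
  rw [hH.hessEnd_apply_swap hG hy l l i j, ← Matrix.sub_apply,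
    hessEnd_sub_hessEnd (hG.differentiableAt_leviCivita hy) (hG.leviCivita_symm hy)
      (hH.contDiffAt y hy)]

lemma sum_trace_mul_hessEnd_nonpos (h1 : G y = 1)
    (hmax : IsLocalMax (fun z => (H z * H z).trace) y) :
    ∑ m, (H y * hessEnd (leviCivita G) m m H y).trace ≤ 0 := by
  have hH₁ := (hH.contDiffAt y hy).differentiableAt (by simp)
  have hcrit (p : Fin n) : (H y * covDeriv (leviCivita G) p H y).trace = 0 := by
    have h := pderiv_trace_mul_self (Γ := leviCivita G) hH₁ p
    rw [pderiv, hmax.fderiv_eq_zero] at h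
    simpa using h.symm
  refine Finset.sum_nonpos fun m _ => ?_
  have hsecond := pderiv_pderiv_nonpos_of_isLocalMax
    (contDiffAt_linearMap (Matrix.traceLinearMap (Fin n) ℝ ℝ)
      ((hH.contDiffAt y hy).mul (hH.contDiffAt y hy))) hmax m
  simp only [Matrix.traceLinearMap_apply] at hsecond
  rw [pderiv_pderiv_trace_mul_self (hG.contDiffAt_leviCivita hy) (hH.contDiffAt y hy)] at hsecond
  have hsymm := hH.isSymm_mul_covDeriv hG hy m
  rw [h1, one_mul] at hsymm
  have hnorm : 0 ≤ (covDeriv (leviCivita G) m H y * covDeriv (leviCivita G) m H y).trace := by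
    nth_rewrite 1 [← hsymm.eq]
    exact (Matrix.posSemidef_conjTranspose_mul_self _).trace_nonneg
  simp only [hessEnd, mul_sub, Finset.mul_sum, mul_smul_comm, Matrix.trace_sub, Matrix.trace_sum,
    Matrix.trace_smul, hcrit, smul_zero, Finset.sum_const_zero, sub_zero]
  linarith

lemma sum_trace_mul_hessEnd_eq (h1 : G y = 1) (hρ : H y = Matrix.diagonal ρ) :
    ∑ m, (H y * hessEnd (leviCivita G) m m H y).trace
      = ∑ i, ∑ j, curvature G i j i j y * (ρ i * (ρ i - ρ j)) := by
  have hcurv (i j : Fin n) : connCurv (leviCivita G) j i y i j = -curvature G i j i j y := by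
    rw [hG.curvature_swap_both hy, hG.curvature_swap_right hy, neg_neg, hG.curvature_eq hy, h1,
      one_mul]
  calc ∑ m, (H y * hessEnd (leviCivita G) m m H y).trace
      = ∑ i, ρ i * ∑ m, hessEnd (leviCivita G) m m H y i i := by
        simp only [hρ, Matrix.trace, Matrix.diag_apply, Matrix.diagonal_mul, Finset.mul_sum]
        exact Finset.sum_comm
    _ = ∑ i, ∑ j, curvature G i j i j y * (ρ i * (ρ i - ρ j)) := by
        refine Finset.sum_congr rfl fun i _ => ?_
        rw [hH.laplacian_eq hG hy h1, Finset.mul_sum]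
        refine Finset.sum_congr rfl fun j _ => ?_
        rw [hρ, Matrix.sub_apply, Matrix.mul_diagonal, Matrix.diagonal_mul, hcurv]
        ring

lemma sum_curvature_mul_sq_nonpos (h1 : G y = 1) (hρ : H y = Matrix.diagonal ρ)
    (hmax : IsLocalMax (fun z => (H z * H z).trace) y) :
    ∑ i, ∑ j, curvature G i j i j y * (ρ i - ρ j) ^ 2 ≤ 0 := by
  have hnonpos := hH.sum_trace_mul_hessEnd_nonpos hG hy h1 hmax
  rw [hH.sum_trace_mul_hessEnd_eq hG hy h1 hρ] at hnonpos
  have hswap : ∑ i, ∑ j, curvature G i j i j y * (ρ i * (ρ i - ρ j))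
      = ∑ i, ∑ j, curvature G i j i j y * (ρ j * (ρ j - ρ i)) := by
    rw [Finset.sum_comm]
    simp only [fun i j => hG.curvature_swap_both hy j i j i]
  calc ∑ i, ∑ j, curvature G i j i j y * (ρ i - ρ j) ^ 2
      = ∑ i, ∑ j, curvature G i j i j y * (ρ i * (ρ i - ρ j))
        + ∑ i, ∑ j, curvature G i j i j y * (ρ j * (ρ j - ρ i)) := by
        simp only [← Finset.sum_add_distrib]
        exact Finset.sum_congr rfl fun i _ => Finset.sum_congr rfl fun j _ => by ring
    _ ≤ 0 := by linarith

end IsCodazziOn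

end Codazzi

section Ricci

variable {n : ℕ} {U : Set (EuclideanSpace ℝ (Fin n))} {y : EuclideanSpace ℝ (Fin n)}
  {G : EuclideanSpace ℝ (Fin n) → Matrix (Fin n) (Fin n) ℝ}

/-- The Ricci tensor with one index raised. -/
def ricEnd (G : EuclideanSpace ℝ (Fin n) → Matrix (Fin n) (Fin n) ℝ)
    (y : EuclideanSpace ℝ (Fin n)) : Matrix (Fin n) (Fin n) ℝ :=
  (G y)⁻¹ * connRicci (leviCivita G) y

/-- The scalar curvature. -/
def scalCurv (G : EuclideanSpace ℝ (Fin n) → Matrix (Fin n) (Fin n) ℝ)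
    (y : EuclideanSpace ℝ (Fin n)) : ℝ :=
  (ricEnd G y).trace

/-- The squared norm of the Ricci tensor. -/
def ricNormSq (G : EuclideanSpace ℝ (Fin n) → Matrix (Fin n) (Fin n) ℝ)
    (y : EuclideanSpace ℝ (Fin n)) : ℝ :=
  (ricEnd G y * ricEnd G y).trace

namespace IsMetricOn

variable (hG : IsMetricOn U G) (hy : y ∈ U)
include hG hy

lemma contDiffAt_ricEnd : ContDiffAt ℝ ∞ (ricEnd G) y :=
  (hG.contDiffAt_inv hy).mul (hG.contDiffAt_connRicci hy)

lemma contDiffAt_scalCurv : ContDiffAt ℝ ∞ (scalCurv G) y :=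
  contDiffAt_linearMap (Matrix.traceLinearMap (Fin n) ℝ ℝ) (hG.contDiffAt_ricEnd hy)

lemma contDiffAt_ricNormSq : ContDiffAt ℝ ∞ (ricNormSq G) y :=
  contDiffAt_linearMap (Matrix.traceLinearMap (Fin n) ℝ ℝ)
    ((hG.contDiffAt_ricEnd hy).mul (hG.contDiffAt_ricEnd hy))

lemma mul_ricEnd : G y * ricEnd G y = connRicci (leviCivita G) y := by
  rw [ricEnd, ← mul_assoc, Matrix.mul_nonsing_inv _ (hG.isUnit_det hy), one_mul]

lemma covDeriv_ricEnd (m : Fin n) : covDeriv (leviCivita G) m (ricEnd G) y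
    = (G y)⁻¹ * covForm (leviCivita G) m (connRicci (leviCivita G)) y := by
  have hlower : (fun z => G z * ricEnd G z) =ᶠ[nhds y] connRicci (leviCivita G) :=
    hG.eventually_of_forall_mem hy fun z hz => hG.mul_ricEnd hz
  rw [← covForm_congr hlower,
    hG.covForm_metric_mul hy ((hG.contDiffAt_ricEnd hy).differentiableAt (by simp)), ← mul_assoc,
    Matrix.nonsing_inv_mul _ (hG.isUnit_det hy), one_mul]

lemma covForm_connRicci_symm (m : Fin n) :
    (covForm (leviCivita G) m (connRicci (leviCivita G)) y).IsSymm := by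
  rw [Matrix.IsSymm, ← covForm_transpose ((hG.contDiffAt_connRicci hy).differentiableAt (by simp))]
  exact covForm_congr (hG.eventually_of_forall_mem hy fun z hz => hG.connRicci_symm hz) m

end IsMetricOn

lemma IsMetricOn.isCodazziOn_ricEnd (hG : IsMetricOn U G)
    (hharm : ∀ z ∈ U, ∀ j k l, divCurvature G j k l z = 0) : IsCodazziOn U G (ricEnd G) := by
  have hswap : ∀ z ∈ U, ∀ m i j, covDeriv (leviCivita G) m (ricEnd G) z i j
      = covDeriv (leviCivita G) j (ricEnd G) z i m := by
    intro z hz m i j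
    have hcodazzi (p : Fin n) := hharm z hz p m j
    simp only [hG.divCurvature_eq hz, sub_eq_zero] at hcodazzi
    simp only [hG.covDeriv_ricEnd hz, Matrix.mul_apply]
    refine Finset.sum_congr rfl fun p _ => ?_
    rw [(hG.covForm_connRicci_symm hz m).apply, hcodazzi,
      (hG.covForm_connRicci_symm hz j).apply]
  refine ⟨fun z hz => hG.contDiffAt_ricEnd hz, fun z hz => ?_, hswap, fun z hz k => ?_⟩
  · rw [hG.mul_ricEnd hz]
    exact hG.connRicci_symm hz
  · calc (covDeriv (leviCivita G) k (ricEnd G) z).trace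
        = ∑ m, covDeriv (leviCivita G) m (ricEnd G) z m k :=
          Finset.sum_congr rfl fun m _ => hswap z hz k m m
      _ = ∑ j, ∑ l, (G z)⁻¹ j l * divCurvature G j k l z := by
          rw [hG.sum_inv_mul_divCurvature hz]
          simp only [hG.covDeriv_ricEnd hz, Matrix.mul_apply]
      _ = 0 := by simp only [hharm z hz, mul_zero, Finset.sum_const_zero]

lemma IsMetricOn.pderiv_scalCurv (hG : IsMetricOn U G)
    (hharm : ∀ z ∈ U, ∀ j k l, divCurvature G j k l z = 0) (hy : y ∈ U) (k : Fin n) :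
    pderiv k (scalCurv G) y = 0 := by
  rw [← (hG.isCodazziOn_ricEnd hharm).trace_covDeriv y hy k,
    trace_covDeriv ((hG.contDiffAt_ricEnd hy).differentiableAt (by simp))]
  rfl

lemma IsMetricOn.scalCurv_eventually_eq (hG : IsMetricOn U G)
    (hharm : ∀ z ∈ U, ∀ j k l, divCurvature G j k l z = 0) (hy : y ∈ U) :
    ∀ᶠ z in nhds y, scalCurv G z = scalCurv G y := by
  obtain ⟨ε, hε, hball⟩ := Metric.isOpen_iff.1 hG.isOpen y hy
  filter_upwards [Metric.ball_mem_nhds y hε] with z hz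
  refine Metric.isOpen_ball.is_const_of_fderiv_eq_zero (𝕜 := ℝ)
    (convex_ball y ε).isPreconnected (fun w hw => ?_) (fun w hw => ?_) hz
    (Metric.mem_ball_self hε)
  · exact ((hG.contDiffAt_scalCurv (hball hw)).differentiableAt
      (by simp)).differentiableWithinAt
  · ext v
    simp only [fderiv_apply_eq_sum_pderiv, hG.pderiv_scalCurv hharm (hball hw), smul_zero,
      Finset.sum_const_zero, Pi.zero_apply, zero_apply]

lemma IsMetricOn.ricEnd_diagonal_apply_eq_sum (hG : IsMetricOn U G) (hy : y ∈ U) (h1 : G y = 1)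
    {ρ : Fin n → ℝ} (hρ : ricEnd G y = Matrix.diagonal ρ) (i : Fin n) :
    ρ i = ∑ j, curvature G i j i j y := by
  have hric : ricci G i i y = ρ i := by
    rw [hG.ricci_eq hy, ← hG.mul_ricEnd hy, h1, hρ, one_mul, Matrix.diagonal_apply_eq]
  rw [← hric]
  simp [ricci, h1, Matrix.one_apply]

lemma frameCurvature_one (G : EuclideanSpace ℝ (Fin n) → Matrix (Fin n) (Fin n) ℝ)
    (y : EuclideanSpace ℝ (Fin n)) :
    frameCurvature G 1 y = fun a b c d => curvature G a b c d y := by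
  funext a b c d
  simp [frameCurvature, Matrix.one_apply]

end Ricci

section CoordinateChange

variable {n : ℕ} {𝔸 : Type*} [NormedRing 𝔸] [NormedAlgebra ℝ 𝔸] {x : EuclideanSpace ℝ (Fin n)}
  {ψ : EuclideanSpace ℝ (Fin n) → EuclideanSpace ℝ (Fin n)}

/-- The Jacobi matrix `J_ai = ∂_i ψ^a`. -/
def jacobiMat (ψ : EuclideanSpace ℝ (Fin n) → EuclideanSpace ℝ (Fin n))
    (x : EuclideanSpace ℝ (Fin n)) : Matrix (Fin n) (Fin n) ℝ :=
  Matrix.of fun a i => pderiv i ψ x a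

/-- The pullback along `ψ` of the connection form `Γ`. -/
def pullConn (ψ : EuclideanSpace ℝ (Fin n) → EuclideanSpace ℝ (Fin n))
    (Γ : Fin n → EuclideanSpace ℝ (Fin n) → 𝔸) (i : Fin n) (x : EuclideanSpace ℝ (Fin n)) : 𝔸 :=
  ∑ a, jacobiMat ψ x a i • Γ a (ψ x)

lemma contDiffAt_jacobiMat (hψ : ContDiffAt ℝ ∞ ψ x) : ContDiffAt ℝ ∞ (jacobiMat ψ) x :=
  contDiffAt_matrix fun a _ => contDiffAt_linearMap
    (EuclideanSpace.proj a : EuclideanSpace ℝ (Fin n) →L[ℝ] ℝ).toLinearMap (contDiffAt_pderiv hψ)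

lemma differentiableAt_jacobiMat_apply (hψ : ContDiffAt ℝ ∞ ψ x) (a i : Fin n) :
    DifferentiableAt ℝ (fun z => jacobiMat ψ z a i) x :=
  (contDiffAt_matrix_apply (contDiffAt_jacobiMat hψ) a i).differentiableAt (by simp)

lemma pderiv_jacobiMat_symm (hψ : ContDiffAt ℝ ∞ ψ x) (i a k : Fin n) :
    pderiv i (jacobiMat ψ) x a k = pderiv k (jacobiMat ψ) x a i := by
  have hsecond (b c : Fin n) : pderiv b (jacobiMat ψ) x a c = pderiv b (pderiv c ψ) x a := by
    rw [← pderiv_matrix_apply ((contDiffAt_jacobiMat hψ).differentiableAt (by simp))]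
    exact pderiv_linearMap (EuclideanSpace.proj a : EuclideanSpace ℝ (Fin n) →L[ℝ] ℝ).toLinearMap
      ((contDiffAt_pderiv hψ).differentiableAt (by simp))
  rw [hsecond, hsecond, pderiv_comm (hψ.of_le (by norm_cast))]

lemma pderiv_comp {F : Type*} [NormedAddCommGroup F] [NormedSpace ℝ F]
    {f : EuclideanSpace ℝ (Fin n) → F} (hf : DifferentiableAt ℝ f (ψ x))
    (hψ : DifferentiableAt ℝ ψ x) (i : Fin n) :
    pderiv i (fun z => f (ψ z)) x = ∑ a, jacobiMat ψ x a i • pderiv a f (ψ x) := by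
  rw [pderiv, fderiv_fun_comp x hf hψ, ContinuousLinearMap.comp_apply, fderiv_apply_eq_sum_pderiv]
  rfl

variable {Γ Γ' : Fin n → EuclideanSpace ℝ (Fin n) → 𝔸} {J : EuclideanSpace ℝ (Fin n) → 𝔸}

lemma differentiableAt_pullConn (hψ : ContDiffAt ℝ ∞ ψ x)
    (hΓ : ∀ a, DifferentiableAt ℝ (Γ a) (ψ x)) (i : Fin n) :
    DifferentiableAt ℝ (pullConn ψ Γ i) x :=
  DifferentiableAt.fun_sum fun a _ => (differentiableAt_jacobiMat_apply hψ a i).fun_smul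
    ((hΓ a).comp x (hψ.differentiableAt (by simp)))

lemma pderiv_pullConn (hψ : ContDiffAt ℝ ∞ ψ x) (hΓ : ∀ a, DifferentiableAt ℝ (Γ a) (ψ x))
    (k l : Fin n) :
    pderiv k (pullConn ψ Γ l) x = ∑ a, pderiv k (jacobiMat ψ) x a l • Γ a (ψ x)
      + ∑ b, ∑ a, (jacobiMat ψ x b k * jacobiMat ψ x a l) • pderiv b (Γ a) (ψ x) := by
  have hψ₁ : DifferentiableAt ℝ ψ x := hψ.differentiableAt (by simp)
  have hcomp (a : Fin n) : DifferentiableAt ℝ (fun z => Γ a (ψ z)) x := (hΓ a).comp x hψ₁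
  have hcoeff (a : Fin n) := differentiableAt_jacobiMat_apply hψ a l
  change pderiv k (fun z => ∑ a, jacobiMat ψ z a l • Γ a (ψ z)) x = _
  rw [pderiv_sum fun a _ => (hcoeff a).fun_smul (hcomp a), Finset.sum_comm,
    ← Finset.sum_add_distrib]
  refine Finset.sum_congr rfl fun a _ => ?_
  rw [pderiv_smul (hcoeff a) (hcomp a), pderiv_comp (hΓ a) hψ₁,
    pderiv_matrix_apply ((contDiffAt_jacobiMat hψ).differentiableAt (by simp)) a l,
    Finset.smul_sum]
  simp only [smul_smul, mul_comm]

lemma connCurv_pullConn (hψ : ContDiffAt ℝ ∞ ψ x) (hΓ : ∀ a, DifferentiableAt ℝ (Γ a) (ψ x))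
    (i j : Fin n) :
    connCurv (pullConn ψ Γ) i j x
      = ∑ a, ∑ b, (jacobiMat ψ x a i * jacobiMat ψ x b j) • connCurv Γ a b (ψ x) := by
  have hmul (k l : Fin n) : pullConn ψ Γ k x * pullConn ψ Γ l x
      = ∑ a, ∑ b, (jacobiMat ψ x a k * jacobiMat ψ x b l) • (Γ a (ψ x) * Γ b (ψ x)) := by
    simp only [pullConn, Finset.sum_mul_sum, smul_mul_smul_comm]
  have hswap (Z : Fin n → Fin n → 𝔸) :
      ∑ a, ∑ b, (jacobiMat ψ x a j * jacobiMat ψ x b i) • Z a b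
        = ∑ a, ∑ b, (jacobiMat ψ x a i * jacobiMat ψ x b j) • Z b a := by
    rw [Finset.sum_comm]
    simp only [mul_comm]
  simp only [connCurv, pderiv_pullConn hψ hΓ, hmul, hswap, pderiv_jacobiMat_symm hψ i _ j,
    add_sub_add_left_eq_sub, ← Finset.sum_sub_distrib, ← Finset.sum_add_distrib, ← smul_sub,
    ← smul_add]

lemma mul_connCurv_of_gauge (hJ : ContDiffAt ℝ ∞ J x) (hΓ : ∀ i, DifferentiableAt ℝ (Γ i) x)
    (hΓ' : ∀ i, DifferentiableAt ℝ (Γ' i) x)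
    (hgauge : ∀ᶠ z in nhds x, ∀ i, J z * Γ' i z = Γ i z * J z + pderiv i J z) (i j : Fin n) :
    J x * connCurv Γ' i j x = connCurv Γ i j x * J x := by
  have hJ₁ : DifferentiableAt ℝ J x := hJ.differentiableAt (by simp)
  have hderiv (k l : Fin n) : J x * pderiv k (Γ' l) x
      = pderiv k (Γ l) x * J x + Γ l x * pderiv k J x + pderiv k (pderiv l J) x
        - pderiv k J x * Γ' l x := by
    rw [eq_sub_iff_add_eq', ← pderiv_mul hJ₁ (hΓ' l), pderiv_congr (hgauge.mono fun z hz => hz l),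
      pderiv_add ((hΓ l).fun_mul hJ₁) ((contDiffAt_pderiv hJ).differentiableAt (by simp)),
      pderiv_mul (hΓ l) hJ₁]
  have hmul (k l : Fin n) : J x * (Γ' k x * Γ' l x)
      = Γ k x * (Γ l x * J x + pderiv l J x) + pderiv k J x * Γ' l x := by
    rw [← mul_assoc, hgauge.self_of_nhds, add_mul, mul_assoc, hgauge.self_of_nhds]
  simp only [connCurv, mul_add, mul_sub, hderiv, hmul, pderiv_comm (i := j) (j := i)
    (hJ.of_le (by norm_cast))]
  noncomm_ring

end CoordinateChange

section Isometries

variable {n : ℕ} {U V : Set (EuclideanSpace ℝ (Fin n))} {x : EuclideanSpace ℝ (Fin n)}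
  {G G' : EuclideanSpace ℝ (Fin n) → Matrix (Fin n) (Fin n) ℝ}
  {ψ : EuclideanSpace ℝ (Fin n) → EuclideanSpace ℝ (Fin n)}

/-- `ψ` is a smooth map from `V` to `U` that pulls the metric `G` back to the metric `G'`. -/
structure IsIsometryOn (V U : Set (EuclideanSpace ℝ (Fin n)))
    (G' G : EuclideanSpace ℝ (Fin n) → Matrix (Fin n) (Fin n) ℝ)
    (ψ : EuclideanSpace ℝ (Fin n) → EuclideanSpace ℝ (Fin n)) : Prop where
  source : IsMetricOn V G'
  target : IsMetricOn U G
  smooth : ContDiffOn ℝ ∞ ψ V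
  mapsTo : Set.MapsTo ψ V U
  pullback : ∀ x ∈ V, G' x = (jacobiMat ψ x).transpose * G (ψ x) * jacobiMat ψ x

namespace IsIsometryOn

variable (hψ : IsIsometryOn V U G' G ψ) (hx : x ∈ V)
include hψ hx

lemma contDiffAt : ContDiffAt ℝ ∞ ψ x := hψ.smooth.contDiffAt (hψ.source.mem_nhds hx)

lemma isUnit_det : IsUnit (jacobiMat ψ x).det := by
  have hdet := hψ.source.det_ne x hx
  rw [hψ.pullback x hx, Matrix.det_mul] at hdet
  exact (right_ne_zero_of_mul hdet).isUnit

lemma pderiv_metric_comp (k : Fin n) :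
    pderiv k (fun z => G (ψ z)) x = (pullConn ψ (leviCivita G) k x).transpose * G (ψ x)
      + G (ψ x) * pullConn ψ (leviCivita G) k x := by
  have hy := hψ.mapsTo hx
  have hmetric (a : Fin n) : pderiv a G (ψ x)
      = (leviCivita G a (ψ x)).transpose * G (ψ x) + G (ψ x) * leviCivita G a (ψ x) := by
    have hpar := hψ.target.covForm_metric hy a
    rwa [covForm, sub_sub, sub_eq_zero] at hpar
  rw [pderiv_comp (hψ.target.differentiableAt hy) ((hψ.contDiffAt hx).differentiableAt (by simp))]
  simp only [hmetric, pullConn, Matrix.transpose_sum, Matrix.transpose_smul, Finset.sum_mul,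
    Finset.mul_sum, smul_add, Finset.sum_add_distrib, smul_mul_assoc, mul_smul_comm]

lemma pderiv_pullback (k : Fin n) :
    pderiv k G' x = ((pullConn ψ (leviCivita G) k x * jacobiMat ψ x
        + pderiv k (jacobiMat ψ) x).transpose * G (ψ x)) * jacobiMat ψ x
      + (jacobiMat ψ x).transpose * G (ψ x) * (pullConn ψ (leviCivita G) k x * jacobiMat ψ x
        + pderiv k (jacobiMat ψ) x) := by
  have hJ : DifferentiableAt ℝ (jacobiMat ψ) x :=
    (contDiffAt_jacobiMat (hψ.contDiffAt hx)).differentiableAt (by simp)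
  have hJt : DifferentiableAt ℝ (fun z => (jacobiMat ψ z).transpose) x :=
    (contDiffAt_linearMap (Matrix.transposeLinearEquiv (Fin n) (Fin n) ℝ ℝ).toLinearMap
      (contDiffAt_jacobiMat (hψ.contDiffAt hx))).differentiableAt (by simp)
  have hGψ : DifferentiableAt ℝ (fun z => G (ψ z)) x :=
    (hψ.target.differentiableAt (hψ.mapsTo hx)).comp x
      ((hψ.contDiffAt hx).differentiableAt (by simp))
  rw [pderiv_congr (hψ.source.eventually_of_forall_mem hx hψ.pullback),
    pderiv_mul (hJt.fun_mul hGψ) hJ, pderiv_mul hJt hGψ, pderiv_transpose hJ,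
    hψ.pderiv_metric_comp hx, Matrix.transpose_add, Matrix.transpose_mul]
  noncomm_ring

lemma jacobiMat_mul_leviCivita (i : Fin n) :
    jacobiMat ψ x * leviCivita G' i x
      = pullConn ψ (leviCivita G) i x * jacobiMat ψ x + pderiv i (jacobiMat ψ) x := by
  set D : Fin n → Matrix (Fin n) (Fin n) ℝ := fun i =>
    pullConn ψ (leviCivita G) i x * jacobiMat ψ x + pderiv i (jacobiMat ψ) x with hD
  have hcancel (Z : Matrix (Fin n) (Fin n) ℝ) : jacobiMat ψ x * ((jacobiMat ψ x)⁻¹ * Z) = Z :=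
    Matrix.mul_nonsing_inv_cancel_left _ _ (hψ.isUnit_det hx)
  have hsymm (i a m : Fin n) : D i a m = D m a i := by
    simp only [hD, Matrix.add_apply, pderiv_jacobiMat_symm (hψ.contDiffAt hx) i a m, pullConn,
      Matrix.mul_apply, Matrix.sum_apply, Matrix.smul_apply, smul_eq_mul, Finset.sum_mul]
    rw [Finset.sum_comm]
    congr! 3 with b _ c _
    rw [hψ.target.leviCivita_symm (hψ.mapsTo hx) b a c]
    ring
  have hunique : leviCivita G' i x = (jacobiMat ψ x)⁻¹ * D i := by
    refine hψ.source.leviCivita_unique hx (C := fun i => (jacobiMat ψ x)⁻¹ * D i) ?_ ?_ i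
    · intro i l m
      simp only [Matrix.mul_apply, hsymm i _ m]
    · intro k
      rw [hψ.pderiv_pullback hx, hψ.pullback x hx, ← mul_assoc _ _ (jacobiMat ψ x),
        ← mul_assoc _ _ (G (ψ x)), ← Matrix.transpose_mul, hcancel, mul_assoc _ (jacobiMat ψ x),
        hcancel]
  rw [hunique, hcancel]

lemma connCurv_eq (i j : Fin n) :
    connCurv (leviCivita G') i j x = ∑ a, ∑ b, (jacobiMat ψ x a i * jacobiMat ψ x b j) •
      ((jacobiMat ψ x)⁻¹ * (connCurv (leviCivita G) a b (ψ x) * jacobiMat ψ x)) := by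
  have hLC := hψ.target.differentiableAt_leviCivita (hψ.mapsTo hx)
  have hgauge := mul_connCurv_of_gauge (contDiffAt_jacobiMat (hψ.contDiffAt hx))
    (differentiableAt_pullConn (hψ.contDiffAt hx) hLC)
    (hψ.source.differentiableAt_leviCivita hx)
    (hψ.source.eventually_of_forall_mem hx fun z hz => hψ.jacobiMat_mul_leviCivita hz) i j
  rw [← Matrix.nonsing_inv_mul_cancel_left (jacobiMat ψ x) (connCurv _ i j x)
    (hψ.isUnit_det hx), hgauge, connCurv_pullConn (hψ.contDiffAt hx) hLC]
  simp only [Finset.sum_mul, Finset.mul_sum, smul_mul_assoc, mul_smul_comm]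

lemma connRicci_eq : connRicci (leviCivita G') x
    = (jacobiMat ψ x).transpose * connRicci (leviCivita G) (ψ x) * jacobiMat ψ x := by
  ext i k
  have hcontract (a b : Fin n) :
      ∑ j, jacobiMat ψ x a j * ((jacobiMat ψ x)⁻¹
        * (connCurv (leviCivita G) a b (ψ x) * jacobiMat ψ x)) j k
        = (connCurv (leviCivita G) a b (ψ x) * jacobiMat ψ x) a k := by
    rw [← Matrix.mul_apply, Matrix.mul_nonsing_inv_cancel_left _ _ (hψ.isUnit_det hx)]
  calc connRicci (leviCivita G') x i k
      = ∑ b, ∑ a, jacobiMat ψ x b i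
          * (connCurv (leviCivita G) a b (ψ x) * jacobiMat ψ x) a k := by
        simp only [connRicci, Matrix.of_apply, hψ.connCurv_eq hx, Matrix.sum_apply,
          Matrix.smul_apply, smul_eq_mul, ← hcontract, Finset.mul_sum]
        rw [Finset.sum_comm_cycle]
        refine Finset.sum_congr rfl fun b _ => Finset.sum_comm.trans ?_
        exact Finset.sum_congr rfl fun a _ => Finset.sum_congr rfl fun j _ => by ring
    _ = ∑ b, jacobiMat ψ x b i * (connRicci (leviCivita G) (ψ x) * jacobiMat ψ x) b k := by
        simp only [← Finset.mul_sum, Matrix.mul_apply, connRicci, Matrix.of_apply, Finset.sum_mul]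
        exact Finset.sum_congr rfl fun b _ => congrArg _ Finset.sum_comm
    _ = _ := by
        rw [mul_assoc, Matrix.mul_apply]
        rfl

lemma ricEnd_eq : ricEnd G' x = (jacobiMat ψ x)⁻¹ * ricEnd G (ψ x) * jacobiMat ψ x := by
  have hdet : IsUnit (jacobiMat ψ x).transpose.det :=
    (Matrix.isUnit_det_transpose _ (hψ.isUnit_det hx))
  rw [ricEnd, ricEnd, hψ.connRicci_eq hx, hψ.pullback x hx, Matrix.mul_inv_rev, Matrix.mul_inv_rev]
  simp only [mul_assoc, Matrix.nonsing_inv_mul_cancel_left _ _ hdet]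

lemma scalCurv_eq : scalCurv G' x = scalCurv G (ψ x) := by
  rw [scalCurv, scalCurv, hψ.ricEnd_eq hx, Matrix.trace_mul_comm, ← mul_assoc,
    Matrix.mul_nonsing_inv _ (hψ.isUnit_det hx), one_mul]

lemma ricNormSq_eq : ricNormSq G' x = ricNormSq G (ψ x) := by
  rw [ricNormSq, ricNormSq, hψ.ricEnd_eq hx]
  simp only [mul_assoc, Matrix.mul_nonsing_inv_cancel_left _ _ (hψ.isUnit_det hx)]
  rw [Matrix.trace_mul_comm]
  simp only [mul_assoc, Matrix.mul_nonsing_inv _ (hψ.isUnit_det hx), mul_one]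

end IsIsometryOn

end Isometries

/-! ### The metric in smooth charts -/

section Charts

lemma apply_mem_transition_source {H M : Type*} [TopologicalSpace H] [TopologicalSpace M]
    {φ φ' : OpenPartialHomeomorph M H} {p : M} (hp : p ∈ φ.source) (hp' : p ∈ φ'.source) :
    φ' p ∈ (φ'.symm.trans φ).source := by
  rw [OpenPartialHomeomorph.trans_source]
  exact ⟨φ'.map_source hp', by simpa [φ'.left_inv hp'] using hp⟩

variable {n : ℕ} {M : Type*} [TopologicalSpace M] [ChartedSpace (EuclideanSpace ℝ (Fin n)) M]
  {φ φ' : OpenPartialHomeomorph M (EuclideanSpace ℝ (Fin n))} {p : M}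

lemma mdifferentiable_of_mem_maximalAtlas (hφ : φ ∈ IsManifold.maximalAtlas (𝓡 n) ∞ M) :
    φ.MDifferentiable (𝓡 n) (𝓡 n) :=
  ⟨(contMDiffOn_of_mem_maximalAtlas hφ).mdifferentiableOn (by simp),
    (contMDiffOn_symm_of_mem_maximalAtlas hφ).mdifferentiableOn (by simp)⟩

lemma contDiffOn_transition (hφ : φ ∈ IsManifold.maximalAtlas (𝓡 n) ∞ M)
    (hφ' : φ' ∈ IsManifold.maximalAtlas (𝓡 n) ∞ M) :
    ContDiffOn ℝ ∞ (φ'.symm.trans φ) (φ'.symm.trans φ).source := by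
  rw [← contMDiffOn_iff_contDiffOn]
  refine (contMDiffOn_of_mem_maximalAtlas hφ).comp
    ((contMDiffOn_symm_of_mem_maximalAtlas hφ').mono ?_) ?_
  all_goals
    rw [OpenPartialHomeomorph.trans_source]
    intro x hx
  exacts [hx.1, hx.2]

lemma mfderiv_symm_eq_mfderiv_symm_transition (hφ : φ ∈ IsManifold.maximalAtlas (𝓡 n) ∞ M)
    (hφ' : φ' ∈ IsManifold.maximalAtlas (𝓡 n) ∞ M) {x : EuclideanSpace ℝ (Fin n)}
    (hx : x ∈ (φ'.symm.trans φ).source) (u : EuclideanSpace ℝ (Fin n)) :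
    mfderiv (𝓡 n) (𝓡 n) φ'.symm x u = mfderiv (𝓡 n) (𝓡 n) φ.symm (φ'.symm.trans φ x)
      (fderiv ℝ (φ'.symm.trans φ) x u) := by
  have hsource := (φ'.symm.trans φ).open_source.mem_nhds hx
  have hlocal : φ'.symm =ᶠ[nhds x] φ.symm ∘ φ'.symm.trans φ := by
    filter_upwards [hsource] with z hz
    rw [OpenPartialHomeomorph.trans_source] at hz
    exact (φ.left_inv hz.2).symm
  have hdiff : MDifferentiableAt (𝓡 n) (𝓡 n) (φ'.symm.trans φ) x :=
    (((contDiffOn_transition hφ hφ').contDiffAt hsource).differentiableAt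
      (by simp)).mdifferentiableAt
  have hcomp := mfderiv_comp x ((mdifferentiable_of_mem_maximalAtlas hφ).mdifferentiableAt_symm
    ((φ'.symm.trans φ).map_source hx).1) hdiff
  rw [mfderiv_eq_fderiv] at hcomp
  rw [hlocal.mfderiv_eq]
  exact DFunLike.congr_fun hcomp u

lemma contMDiffOn_mfderiv_symm [IsManifold (𝓡 n) 1 M]
    (hφ : φ ∈ IsManifold.maximalAtlas (𝓡 n) ∞ M) (v : EuclideanSpace ℝ (Fin n)) :
    ContMDiffOn (𝓡 n) ((𝓡 n).prod 𝓘(ℝ, EuclideanSpace ℝ (Fin n))) ∞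
      (fun y => Bundle.TotalSpace.mk' (EuclideanSpace ℝ (Fin n))
        (E := (TangentSpace (𝓡 n) : M → Type _)) (φ.symm y)
        (mfderiv (𝓡 n) (𝓡 n) φ.symm y v)) φ.target := by
  have htangent := (contMDiffOn_symm_of_mem_maximalAtlas hφ).contMDiffOn_tangentMapWithin
    (m := ∞) (by simp) φ.open_target.uniqueMDiffOn
  have hconst : ContMDiff (𝓡 n) (𝓡 n).tangent ∞ (fun y : EuclideanSpace ℝ (Fin n) =>
      (⟨y, v⟩ : TangentBundle (𝓡 n) (EuclideanSpace ℝ (Fin n)))) :=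
    contMDiff_vectorSpace_iff_contDiff.2 contDiff_const
  refine (htangent.comp hconst.contMDiffOn fun y hy => hy).congr fun y hy => ?_
  simp only [Function.comp, tangentMapWithin, mfderivWithin_of_isOpen φ.open_target hy]

variable [IsManifold (𝓡 n) ∞ M]

lemma exists_chart_jacobiMat_eq {A : Matrix (Fin n) (Fin n) ℝ} (hA : IsUnit A.det)
    (hφ : φ ∈ IsManifold.maximalAtlas (𝓡 n) ∞ M) :
    ∃ φ' ∈ IsManifold.maximalAtlas (𝓡 n) ∞ M, φ'.source = φ.source ∧
      ∀ x ∈ φ'.target, jacobiMat (φ'.symm.trans φ) x = A := by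
  let L : EuclideanSpace ℝ (Fin n) ≃L[ℝ] EuclideanSpace ℝ (Fin n) :=
    ContinuousLinearEquiv.ofUnit (Units.map
      (Matrix.toEuclideanCLM (n := Fin n) (𝕜 := ℝ) : _ →* _) (A.nonsingInvUnit hA))
  refine ⟨φ.transHomeomorph L.symm.toHomeomorph,
    OpenPartialHomeomorph.mem_maximalAtlas_of_contMDiffOn _ ?_ ?_, rfl, fun x hx => ?_⟩
  · exact L.symm.contDiff.contMDiff.comp_contMDiffOn (contMDiffOn_of_mem_maximalAtlas hφ)
  · exact (contMDiffOn_symm_of_mem_maximalAtlas hφ).comp L.contDiff.contMDiff.contMDiffOn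
      fun x hx => hx
  · have hlinear :
        (φ.transHomeomorph L.symm.toHomeomorph).symm.trans φ =ᶠ[nhds x] L := by
      filter_upwards [(φ.transHomeomorph L.symm.toHomeomorph).open_target.mem_nhds hx] with z hz
      exact φ.right_inv hz
    ext a i
    have hcolumn : L (EuclideanSpace.single i 1) a
        = A.mulVec (EuclideanSpace.single i (1 : ℝ)).ofLp a := rfl
    rw [jacobiMat, Matrix.of_apply, pderiv, hlinear.fderiv_eq, L.fderiv]
    exact hcolumn.trans (by simp)

variable (g : Bundle.ContMDiffRiemannianMetric (𝓡 n) ∞ (EuclideanSpace ℝ (Fin n))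
    (TangentSpace (𝓡 n) : M → Type _))

lemma inner_congr {q : M} (h : p = q) (u v : EuclideanSpace ℝ (Fin n)) :
    g.inner p (u : TangentSpace (𝓡 n) p) (v : TangentSpace (𝓡 n) p)
      = g.inner q (u : TangentSpace (𝓡 n) q) (v : TangentSpace (𝓡 n) q) := by
  subst h
  rfl

lemma inner_mfderiv_symm_eq_sum (φ : OpenPartialHomeomorph M (EuclideanSpace ℝ (Fin n)))
    (y u v : EuclideanSpace ℝ (Fin n)) :
    g.inner (φ.symm y) (mfderiv (𝓡 n) (𝓡 n) φ.symm y u) (mfderiv (𝓡 n) (𝓡 n) φ.symm y v)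
      = ∑ i, ∑ j, u i * v j * metricCoeff g φ y i j := by
  let D : EuclideanSpace ℝ (Fin n) →L[ℝ] EuclideanSpace ℝ (Fin n) :=
    mfderiv (𝓡 n) (𝓡 n) φ.symm y
  let b : EuclideanSpace ℝ (Fin n) →L[ℝ] EuclideanSpace ℝ (Fin n) →L[ℝ] ℝ := g.inner (φ.symm y)
  have hbasis (i j : Fin n) : b.bilinearComp D D (EuclideanSpace.single i 1)
      (EuclideanSpace.single j 1) = metricCoeff g φ y i j := rfl
  have hdecomp (w : EuclideanSpace ℝ (Fin n)) :
      w = ∑ i, w i • EuclideanSpace.single i (1 : ℝ) := by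
    ext j
    simp [Finset.sum_apply, Pi.single_apply]
  change b.bilinearComp D D u v = _
  conv_lhs => rw [hdecomp u, hdecomp v]
  simp only [map_sum, map_smul, sum_apply, smul_apply, smul_eq_mul, Finset.mul_sum, hbasis]
  rw [Finset.sum_comm]
  exact Finset.sum_congr rfl fun i _ => Finset.sum_congr rfl fun j _ => by ring

lemma metricCoeff_isSymm (φ : OpenPartialHomeomorph M (EuclideanSpace ℝ (Fin n)))
    (y : EuclideanSpace ℝ (Fin n)) : (metricCoeff g φ y).IsSymm := by
  ext i j
  exact g.symm _ _ _

lemma metricCoeff_posDef (hφ : φ ∈ IsManifold.maximalAtlas (𝓡 n) ∞ M)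
    {y : EuclideanSpace ℝ (Fin n)} (hy : y ∈ φ.target) : (metricCoeff g φ y).PosDef := by
  refine Matrix.PosDef.of_dotProduct_mulVec_pos
    (Matrix.isHermitian_iff_isSymm.2 (metricCoeff_isSymm g φ y)) fun {x} hx => ?_
  have hinj := (mdifferentiable_of_mem_maximalAtlas hφ).symm.mfderiv_injective (x := y) hy
  have hx' : (WithLp.toLp 2 x : EuclideanSpace ℝ (Fin n)) ≠ 0 := by simpa using hx
  have hne : mfderiv (𝓡 n) (𝓡 n) φ.symm y (WithLp.toLp 2 x : EuclideanSpace ℝ (Fin n)) ≠ 0 :=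
    fun hzero => hx' (hinj (hzero.trans (map_zero _).symm))
  refine (g.pos _ _ hne).trans_eq ((inner_mfderiv_symm_eq_sum g φ y _ _).trans ?_)
  simp only [dotProduct, Matrix.mulVec, star_trivial, Finset.mul_sum]
  exact Finset.sum_congr rfl fun i _ => Finset.sum_congr rfl fun j _ => by ring

lemma contDiffAt_metricCoeff_apply (hφ : φ ∈ IsManifold.maximalAtlas (𝓡 n) ∞ M)
    {y : EuclideanSpace ℝ (Fin n)} (hy : y ∈ φ.target) (i j : Fin n) :
    ContDiffAt ℝ ∞ (fun z => metricCoeff g φ z i j) y := by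
  have hinner : ContMDiffOn (𝓡 n) ((𝓡 n).prod 𝓘(ℝ)) ∞
      (fun z => Bundle.TotalSpace.mk' ℝ (E := Bundle.Trivial M ℝ) (φ.symm z)
        (g.inner (φ.symm z) (mfderiv (𝓡 n) (𝓡 n) φ.symm z (EuclideanSpace.single i (1 : ℝ)))
          (mfderiv (𝓡 n) (𝓡 n) φ.symm z (EuclideanSpace.single j (1 : ℝ))))) φ.target :=
    ContMDiffOn.clm_bundle_apply₂ (F₁ := EuclideanSpace ℝ (Fin n))
      (F₂ := EuclideanSpace ℝ (Fin n))
      (g.contMDiff.comp_contMDiffOn (contMDiffOn_symm_of_mem_maximalAtlas hφ))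
      (contMDiffOn_mfderiv_symm hφ _) (contMDiffOn_mfderiv_symm hφ _)
  have hat := hinner y hy
  rw [Bundle.contMDiffWithinAt_totalSpace] at hat
  exact (contMDiffWithinAt_iff_contDiffWithinAt.1 hat.2).contDiffAt (φ.open_target.mem_nhds hy)

lemma isMetricOn_metricCoeff (hφ : φ ∈ IsManifold.maximalAtlas (𝓡 n) ∞ M) :
    IsMetricOn φ.target (metricCoeff g φ) where
  isOpen := φ.open_target
  smooth _ hy := (contDiffAt_matrix (contDiffAt_metricCoeff_apply g hφ hy)).contDiffWithinAt
  symm y _ := metricCoeff_isSymm g φ y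
  det_ne _ hy := (metricCoeff_posDef g hφ hy).det_pos.ne'

lemma metricCoeff_eq_transition (hφ : φ ∈ IsManifold.maximalAtlas (𝓡 n) ∞ M)
    (hφ' : φ' ∈ IsManifold.maximalAtlas (𝓡 n) ∞ M) {x : EuclideanSpace ℝ (Fin n)}
    (hx : x ∈ (φ'.symm.trans φ).source) :
    metricCoeff g φ' x = (jacobiMat (φ'.symm.trans φ) x).transpose
      * metricCoeff g φ (φ'.symm.trans φ x) * jacobiMat (φ'.symm.trans φ) x := by
  have hpoint : φ'.symm x = φ.symm (φ'.symm.trans φ x) := by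
    rw [OpenPartialHomeomorph.trans_source] at hx
    exact (φ.left_inv hx.2).symm
  ext i j
  rw [metricCoeff, Matrix.of_apply, mfderiv_symm_eq_mfderiv_symm_transition hφ hφ' hx,
    mfderiv_symm_eq_mfderiv_symm_transition hφ hφ' hx]
  refine (inner_congr g hpoint _ _).trans ((inner_mfderiv_symm_eq_sum g φ _ _ _).trans ?_)
  simp only [Matrix.mul_apply, Matrix.transpose_apply, Finset.sum_mul]
  rw [Finset.sum_comm]
  refine Finset.sum_congr rfl fun a _ => Finset.sum_congr rfl fun b _ => ?_
  simp only [jacobiMat, pderiv, Matrix.of_apply]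
  ring

lemma isIsometryOn_transition (hφ : φ ∈ IsManifold.maximalAtlas (𝓡 n) ∞ M)
    (hφ' : φ' ∈ IsManifold.maximalAtlas (𝓡 n) ∞ M) :
    IsIsometryOn (φ'.symm.trans φ).source φ.target (metricCoeff g φ') (metricCoeff g φ)
      (φ'.symm.trans φ) where
  source := (isMetricOn_metricCoeff g hφ').mono (φ'.symm.trans φ).open_source fun _ hx => hx.1
  target := isMetricOn_metricCoeff g hφ
  smooth := contDiffOn_transition hφ hφ'
  mapsTo _ hx := ((φ'.symm.trans φ).map_source hx).1
  pullback _ hx := metricCoeff_eq_transition g hφ hφ' hx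

lemma scalCurv_chart_eq (hφ : φ ∈ IsManifold.maximalAtlas (𝓡 n) ∞ M)
    (hφ' : φ' ∈ IsManifold.maximalAtlas (𝓡 n) ∞ M) (hp : p ∈ φ.source) (hp' : p ∈ φ'.source) :
    scalCurv (metricCoeff g φ') (φ' p) = scalCurv (metricCoeff g φ) (φ p) := by
  simpa [φ'.left_inv hp'] using
    (isIsometryOn_transition g hφ hφ').scalCurv_eq (apply_mem_transition_source hp hp')

lemma ricNormSq_chart_eq (hφ : φ ∈ IsManifold.maximalAtlas (𝓡 n) ∞ M)
    (hφ' : φ' ∈ IsManifold.maximalAtlas (𝓡 n) ∞ M) (hp : p ∈ φ.source) (hp' : p ∈ φ'.source) :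
    ricNormSq (metricCoeff g φ') (φ' p) = ricNormSq (metricCoeff g φ) (φ p) := by
  simpa [φ'.left_inv hp'] using
    (isIsometryOn_transition g hφ hφ').ricNormSq_eq (apply_mem_transition_source hp hp')

lemma exists_chart_ricEnd_diagonal (hφ : φ ∈ IsManifold.maximalAtlas (𝓡 n) ∞ M)
    (hp : p ∈ φ.source) :
    ∃ φ' ∈ IsManifold.maximalAtlas (𝓡 n) ∞ M, p ∈ φ'.source ∧ metricCoeff g φ' (φ' p) = 1 ∧
      ∃ ρ : Fin n → ℝ, ricEnd (metricCoeff g φ') (φ' p) = Matrix.diagonal ρ := by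
  have hy : φ p ∈ φ.target := φ.map_source hp
  obtain ⟨A, ρ, hA, hAρ⟩ := exists_frame_diagonal (metricCoeff_posDef g hφ hy)
    ((isMetricOn_metricCoeff g hφ).connRicci_symm hy)
  obtain ⟨φ', hφ', hsource, hJ⟩ :=
    exists_chart_jacobiMat_eq (isUnit_det_of_transpose_mul_mul hA) hφ
  have hp' : p ∈ φ'.source := hsource ▸ hp
  have hx := apply_mem_transition_source hp hp'
  have hψ := isIsometryOn_transition g hφ hφ'
  have hpoint : φ'.symm.trans φ (φ' p) = φ p := congrArg φ (φ'.left_inv hp')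
  have hG : metricCoeff g φ' (φ' p) = 1 := by
    rw [hψ.pullback _ hx, hJ _ hx.1, hpoint, hA]
  refine ⟨φ', hφ', hp', hG, ρ, ?_⟩
  rw [ricEnd, hG, inv_one, one_mul, hψ.connRicci_eq hx, hJ _ hx.1, hpoint, hAρ]

end Charts

/-! ### Global conclusion -/

section Global

variable {n : ℕ} {M : Type*} [TopologicalSpace M] [ChartedSpace (EuclideanSpace ℝ (Fin n)) M]
  [IsManifold (𝓡 n) ∞ M]
  (g : Bundle.ContMDiffRiemannianMetric (𝓡 n) ∞ (EuclideanSpace ℝ (Fin n))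
    (TangentSpace (𝓡 n) : M → Type _))
  {φ : OpenPartialHomeomorph M (EuclideanSpace ℝ (Fin n))} {p : M}

/-- The scalar curvature as a function on the manifold. -/
def globalScal (p : M) : ℝ :=
  scalCurv (metricCoeff g (chartAt (EuclideanSpace ℝ (Fin n)) p))
    (chartAt (EuclideanSpace ℝ (Fin n)) p p)

/-- The squared norm of the Ricci tensor as a function on the manifold. -/
def globalRicNormSq (p : M) : ℝ :=
  ricNormSq (metricCoeff g (chartAt (EuclideanSpace ℝ (Fin n)) p))
    (chartAt (EuclideanSpace ℝ (Fin n)) p p)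

lemma globalScal_eq (hφ : φ ∈ IsManifold.maximalAtlas (𝓡 n) ∞ M) (hp : p ∈ φ.source) :
    globalScal g p = scalCurv (metricCoeff g φ) (φ p) :=
  scalCurv_chart_eq g hφ (IsManifold.chart_mem_maximalAtlas p) hp (mem_chart_source _ p)

lemma globalRicNormSq_eq (hφ : φ ∈ IsManifold.maximalAtlas (𝓡 n) ∞ M) (hp : p ∈ φ.source) :
    globalRicNormSq g p = ricNormSq (metricCoeff g φ) (φ p) :=
  ricNormSq_chart_eq g hφ (IsManifold.chart_mem_maximalAtlas p) hp (mem_chart_source _ p)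

lemma continuous_globalRicNormSq : Continuous (globalRicNormSq g) := by
  refine continuous_iff_continuousAt.2 fun p => ?_
  set φ := chartAt (EuclideanSpace ℝ (Fin n)) p
  have hφ : φ ∈ IsManifold.maximalAtlas (𝓡 n) ∞ M := IsManifold.chart_mem_maximalAtlas p
  have hp : p ∈ φ.source := mem_chart_source _ p
  have hlocal : ContinuousAt (fun q => ricNormSq (metricCoeff g φ) (φ q)) p :=
    ((isMetricOn_metricCoeff g hφ).contDiffAt_ricNormSq (φ.map_source hp)).continuousAt.comp
      (φ.continuousAt hp)
  refine hlocal.congr ?_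
  filter_upwards [φ.open_source.mem_nhds hp] with q hq
  exact (globalRicNormSq_eq g hφ hq).symm

lemma isLocallyConstant_globalScal (hharm : HasHarmonicCurvature g) :
    IsLocallyConstant (globalScal g) := by
  refine (IsLocallyConstant.iff_eventually_eq _).2 fun p => ?_
  set φ := chartAt (EuclideanSpace ℝ (Fin n)) p
  have hφ : φ ∈ IsManifold.maximalAtlas (𝓡 n) ∞ M := IsManifold.chart_mem_maximalAtlas p
  have hp : p ∈ φ.source := mem_chart_source _ p
  filter_upwards [φ.open_source.mem_nhds hp, (φ.continuousAt hp).eventually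
    ((isMetricOn_metricCoeff g hφ).scalCurv_eventually_eq (hharm φ hφ) (φ.map_source hp))]
    with q hq hscal
  rw [globalScal_eq g hφ hq, globalScal_eq g hφ hp, hscal]

lemma globalRicNormSq_eq_of_forall_le {k : ℝ} (hk : 0 < k) (hkn : k < n)
    (hharm : HasHarmonicCurvature g) (hnonneg : SecondKindKNonnegative g k)
    (hmax : ∀ q, globalRicNormSq g q ≤ globalRicNormSq g p) :
    globalRicNormSq g p = globalScal g p ^ 2 / n := by
  obtain ⟨φ, hφ, hp, h1, ρ, hρ⟩ := exists_chart_ricEnd_diagonal g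
    (IsManifold.chart_mem_maximalAtlas (I := 𝓡 n) (n := ∞) p) (mem_chart_source _ p)
  have hG := isMetricOn_metricCoeff g hφ
  have hy := φ.map_source hp
  have hlocal : IsLocalMax (ricNormSq (metricCoeff g φ)) (φ p) := by
    filter_upwards [φ.open_target.mem_nhds hy] with z hz
    simpa only [globalRicNormSq_eq g hφ (φ.map_target hz), globalRicNormSq_eq g hφ hp,
      φ.right_inv hz] using hmax (φ.symm z)
  have hbochner := (hG.isCodazziOn_ricEnd (hharm φ hφ)).sum_curvature_mul_sq_nonpos hG hy h1 hρ
    hlocal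
  have hsecond := hnonneg φ hφ (φ p) hy 1 (by rw [h1]; simp)
  rw [frameCurvature_one] at hsecond
  have hequal := eq_average_of_isKNonnegative
    ⟨fun i j k l => curvature_swap_left i j k l _, hG.curvature_swap_right hy⟩ hk hkn hsecond
    (hG.ricEnd_diagonal_apply_eq_sum hy h1 hρ) hbochner
  have hn : (n : ℝ) ≠ 0 := (hk.trans hkn).ne'
  have hsum : ∑ i, ρ i * ρ i = ∑ _i : Fin n, ((∑ j, ρ j) / n) * ((∑ j, ρ j) / n) :=
    Finset.sum_congr rfl fun i _ => by rw [hequal i]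
  rw [globalRicNormSq_eq g hφ hp, globalScal_eq g hφ hp, ricNormSq, scalCurv, hρ,
    Matrix.diagonal_mul_diagonal, Matrix.trace_diagonal, Matrix.trace_diagonal, hsum,
    Finset.sum_const, Finset.card_univ, Fintype.card_fin, nsmul_eq_mul]
  field_simp

lemma isEinstein_of_globalRicNormSq_le {c : ℝ} (hscal : ∀ q, globalScal g q = c)
    (hle : ∀ q, globalRicNormSq g q ≤ c ^ 2 / n) : IsEinstein g := by
  refine ⟨c / n, fun φ hφ y hy i j => ?_⟩
  have hG := isMetricOn_metricCoeff g hφ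
  have hq : φ.symm y ∈ φ.source := φ.map_target hy
  have hscal' : scalCurv (metricCoeff g φ) y = c := by
    rw [← hscal (φ.symm y), globalScal_eq g hφ hq, φ.right_inv hy]
  have hle' : ricNormSq (metricCoeff g φ) y ≤ scalCurv (metricCoeff g φ) y ^ 2 / n := by
    rw [hscal', ← φ.right_inv hy, ← globalRicNormSq_eq g hφ hq]
    exact hle _
  have hsmul := eq_smul_of_trace_sq_le (metricCoeff_posDef g hφ hy) (hG.connRicci_symm hy)
    (by rwa [Fintype.card_fin])
  rw [hG.ricci_eq hy, hsmul, Matrix.smul_apply, smul_eq_mul, Fintype.card_fin, ← hscal']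
  rfl

end Global

end HarmonicCurvature

end

theorem theoremA_general {n : ℕ} {M : Type*} [TopologicalSpace M] [CompactSpace M]
    [ConnectedSpace M] [ChartedSpace (EuclideanSpace ℝ (Fin n)) M] [IsManifold (𝓡 n) ∞ M]
    (g : Bundle.ContMDiffRiemannianMetric (𝓡 n) ∞ (EuclideanSpace ℝ (Fin n))
      (TangentSpace (𝓡 n) : M → Type _))
    {k : ℝ} (hk : 0 < k) (hkn : k < n) (hharm : HarmonicCurvature.HasHarmonicCurvature g)
    (hnonneg : HarmonicCurvature.SecondKindKNonnegative g k) :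
    HarmonicCurvature.IsEinstein g := by
  obtain ⟨p, -, hp⟩ := isCompact_univ.exists_isMaxOn (Set.univ_nonempty (α := M))
    (HarmonicCurvature.continuous_globalRicNormSq g).continuousOn
  have hmax (q : M) := hp (Set.mem_univ q)
  have hscal (q : M) := (HarmonicCurvature.isLocallyConstant_globalScal g
    hharm).apply_eq_of_preconnectedSpace q p
  exact HarmonicCurvature.isEinstein_of_globalRicNormSq_le g hscal fun q => (hmax q).trans_eq
    (HarmonicCurvature.globalRicNormSq_eq_of_forall_le g hk hkn hharm hnonneg hmax)

theorem theoremA {n : ℕ} (hn : 3 ≤ n) {M : Type*} [TopologicalSpace M] [T2Space M]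
    [CompactSpace M] [ConnectedSpace M] [ChartedSpace (EuclideanSpace ℝ (Fin n)) M]
    [IsManifold (𝓡 n) ∞ M]
    (g : Bundle.ContMDiffRiemannianMetric (𝓡 n) ∞ (EuclideanSpace ℝ (Fin n))
      (TangentSpace (𝓡 n) : M → Type _))
    (hharm : HarmonicCurvature.HasHarmonicCurvature g)
    (hnonneg : HarmonicCurvature.SecondKindKNonnegative g
      ((n : ℝ) * (n + 2) / (2 * (n + 1)))) :
    HarmonicCurvature.IsEinstein g := by
  have hn' : (3 : ℝ) ≤ n := by exact_mod_cast hn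
  refine theoremA_general g (by positivity) ?_ hharm hnonneg
  rw [div_lt_iff₀ (by positivity)]
  nlinarith
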